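/- Let $T$ be the $3$-regular rooted tree, whose vertices are the finite words over $\{0,1,2\}$ (two words being adjacent if one is obtained from the other by appending a letter). Let $a$ be the automorphism of $T$ that permutes the three first-level subtrees cyclically, $xw\mapsto (x+1 \bmod 3)\,w$, and let $b=(a,a^{-1},b)$ be the automorphism of $T$ that fixes the first level and is defined recursively by acting as $a$ on the subtree rooted at $0$, as $a^{-1}$ on the subtree rooted at $1$, and as $b$ on the subtree rooted at $2$ (each subtree being identified with $T$). Let $G=\langle a,b\rangle\le\operatorname{Aut}T$ be the Gupta–Sidki $3$-group. Then every infinite finitely generated subgroup $H$ of $G$ is (abstractly) commensurable with $G$ or with $G\times G$; that is, $H$ has a finite-index subgroup which is isomorphic to a finite-index subgroup of $G$ or of $G\times G$. -/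

import Mathlib

/-- Two groups are (abstractly) commensurable if they have isomorphic subgroups of finite index. -/
def AbstractlyCommensurable (H K : Type*) [Group H] [Group K] : Prop :=
  ∃ (A : Subgroup H) (B : Subgroup K), A.FiniteIndex ∧ B.FiniteIndex ∧ Nonempty (A ≃* B)

namespace GuptaSidki

/-- The vertices of the 3-regular rooted tree: finite words over the alphabet `{0, 1, 2}`.
The root is the empty word. -/
abbrev Vertex : Type := List (Fin 3)

/-- The 3-regular rooted tree: two words are adjacent if one is obtained from the other by
appending one letter. -/
def tree : SimpleGraph Vertex where
  Adj u v := (∃ x : Fin 3, v = u ++ [x]) ∨ (∃ x : Fin 3, u = v ++ [x])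
  symm := ⟨fun _ _ h => h.symm⟩
  loopless := ⟨fun u h => by
    rcases h with ⟨x, hx⟩ | ⟨x, hx⟩ <;> simpa using congrArg List.length hx⟩

/-- The group of automorphisms of the 3-regular rooted tree (the root is fixed automatically,
being the only vertex of degree 3). -/
abbrev TreeAut : Type := tree ≃g tree

/-- A permutation of the vertices which, together with its inverse, maps words extended by a
letter to words extended by a letter, is an automorphism of the tree. -/
def mkAut (f g : Vertex → Vertex) (hgf : Function.LeftInverse g f)
    (hfg : Function.RightInverse g f)
    (hf : ∀ u x, ∃ y, f (u ++ [x]) = f u ++ [y])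
    (hg : ∀ u x, ∃ y, g (u ++ [x]) = g u ++ [y]) : TreeAut where
  toFun := f
  invFun := g
  left_inv := hgf
  right_inv := hfg
  map_rel_iff' := by
    have key : ∀ k : Vertex → Vertex, (∀ u x, ∃ y, k (u ++ [x]) = k u ++ [y]) →
        ∀ u v, tree.Adj u v → tree.Adj (k u) (k v) := by
      rintro k hk u v (⟨x, rfl⟩ | ⟨x, rfl⟩)
      · exact Or.inl (hk u x)
      · exact Or.inr (hk v x)
    intro u v
    refine ⟨fun h => ?_, key f hf u v⟩
    have h2 := key g hg _ _ h
    simpa only [Equiv.coe_fn_mk, hgf u, hgf v] using h2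

/-- Add `c` (mod 3) to the first letter of a word. -/
def rot (c : Fin 3) : Vertex → Vertex
  | [] => []
  | x :: w => (x + c) :: w

theorem rot_rot (c d : Fin 3) (h : c + d = 0) (u : Vertex) : rot d (rot c u) = u := by
  cases u with
  | nil => rfl
  | cons x w => simp [rot, add_assoc, h]

theorem rot_append (c : Fin 3) (u : Vertex) (x : Fin 3) :
    ∃ y, rot c (u ++ [x]) = rot c u ++ [y] := by
  cases u with
  | nil => exact ⟨x + c, rfl⟩
  | cons z w => exact ⟨x, rfl⟩

/-- The map fixing the first layer, acting as `rot c` on the subtree rooted at `0`, as `rot d` on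
the subtree rooted at `1`, and, recursively, as itself on the subtree rooted at `2`. -/
def dir (c d : Fin 3) : Vertex → Vertex
  | [] => []
  | 0 :: w => 0 :: rot c w
  | 1 :: w => 1 :: rot d w
  | 2 :: w => 2 :: dir c d w

theorem dir_dir (c d : Fin 3) (h : c + d = 0) (u : Vertex) : dir d c (dir c d u) = u := by
  induction u with
  | nil => rfl
  | cons x w ih =>
    have h' : d + c = 0 := by rw [add_comm, h]
    fin_cases x
    · simp [dir, rot_rot c d h]
    · simp [dir, rot_rot d c h']
    · simpa [dir] using ih

theorem dir_append (c d : Fin 3) (u : Vertex) (x : Fin 3) :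
    ∃ y, dir c d (u ++ [x]) = dir c d u ++ [y] := by
  induction u with
  | nil => fin_cases x <;> exact ⟨_, rfl⟩
  | cons z w ih =>
    fin_cases z
    · obtain ⟨y, hy⟩ := rot_append c w x
      exact ⟨y, by simp [dir, hy]⟩
    · obtain ⟨y, hy⟩ := rot_append d w x
      exact ⟨y, by simp [dir, hy]⟩
    · obtain ⟨y, hy⟩ := ih
      exact ⟨y, by simp [dir, hy]⟩

/-- The automorphism `a` permuting the first-level subtrees cyclically: `x w ↦ (x + 1) w`. -/
def a : TreeAut :=
  mkAut (rot 1) (rot 2) (rot_rot 1 2 rfl) (rot_rot 2 1 rfl) (rot_append 1) (rot_append 2)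

/-- The automorphism `b = (a, a⁻¹, b)`. -/
def b : TreeAut :=
  mkAut (dir 1 2) (dir 2 1) (dir_dir 1 2 rfl) (dir_dir 2 1 rfl) (dir_append 1 2) (dir_append 2 1)

theorem b_nil : b [] = [] := rfl

theorem b_zero (w : Vertex) : b (0 :: w) = 0 :: a w := rfl

theorem b_one (w : Vertex) : b (1 :: w) = 1 :: a⁻¹ w := rfl

theorem b_two (w : Vertex) : b (2 :: w) = 2 :: b w := rfl

/-- The Gupta–Sidki 3-group `G = ⟨a, b⟩`. -/
def G : Subgroup TreeAut := Subgroup.closure {a, b}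

end GuptaSidki

/-
Call a class of subgroups of `G` inductive if it contains `G` and the finite subgroups, is closed
under conjugation, and contains `H` as soon as it contains the three subgroups of first-level
sections of the stabilizer of the first level in `H`.

Every finitely generated `H` lies in every inductive class. It is the group of labels of closed
walks in a Schreier graph of `G` of which only finitely many edges labelled by `b` matter. The
sections of `H` are the groups of closed walks of a graph which has no more edges labelled by `b`.
Passing to a connected component, either the number of these edges drops, or closed walks can be
shortened by taking sections until both `a` and `b` label closed edges and the group is all of `G`.

The groups commensurable with a power of `G` form an inductive class. The point is that a subdirect
product of subgroups of finite index in `G` is virtually a direct product, because `G` is regular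
branch over its commutator subgroup and just infinite. The branch property also makes `G ^ 3`
commensurable with `G`, so a nontrivial power of `G` is commensurable with `G` or `G × G`.
-/

/-! ### Commutators -/

section Commutators

open scoped commutatorElement

variable {Γ : Type*} [Group Γ]

theorem commutatorElement_mul_left_of_commute {z x y : Γ} (hzx : Commute z x)
    (hzy : Commute z y) : ⁅z * x, y⁆ = ⁅x, y⁆ := by
  have hz : Commute z ⁅x, y⁆ :=
    ((hzx.mul_right hzy).mul_right hzx.inv_right).mul_right hzy.inv_right
  rw [commutatorElement_mul_left_eq_conj_mul, hzy.commutator_eq, mul_one, hz.eq,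
    mul_inv_cancel_right]

theorem commutatorElement_mem_left {N : Subgroup Γ} [N.Normal] {g : Γ}
    (hg : g ∈ N) (h : Γ) : ⁅g, h⁆ ∈ N :=
  Subgroup.commutator_le_left N ⊤ (Subgroup.commutator_mem_commutator hg (Subgroup.mem_top h))

theorem commutator_le_of_closure_eq_top {S : Set Γ} (hS : Subgroup.closure S = ⊤)
    {N : Subgroup Γ} [N.Normal] (h : ∀ u ∈ S, ∀ v ∈ S, ⁅u, v⁆ ∈ N) : commutator Γ ≤ N := by
  let π := QuotientGroup.mk' N
  have hcomm : π '' S ⊆ Subgroup.centralizer (π '' S) := by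
    rintro _ ⟨u, hu, rfl⟩ _ ⟨v, hv, rfl⟩
    rw [← commutatorElement_eq_one_iff_mul_comm, ← map_commutatorElement]
    exact (QuotientGroup.eq_one_iff _).2 (h v hv u hu)
  have htop : Subgroup.closure (π '' S) = ⊤ := by
    rw [← MonoidHom.map_closure, hS,
      Subgroup.map_top_of_surjective π (QuotientGroup.mk'_surjective N)]
  have hcentral : π '' S ⊆ Subgroup.center (Γ ⧸ N) := fun u hu =>
    Subgroup.mem_center_iff.2 fun g =>
      (((Subgroup.closure_le _).2 hcomm) (htop ▸ Subgroup.mem_top g) u hu).symm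
  have hcenter (g : Γ ⧸ N) : g ∈ Subgroup.center (Γ ⧸ N) :=
    (Subgroup.closure_le _).2 hcentral (htop ▸ Subgroup.mem_top g)
  exact Subgroup.Normal.quotient_commutative_iff_commutator_le.1
    ⟨⟨fun x y => Subgroup.mem_center_iff.1 (hcenter y) x⟩⟩

end Commutators

/-! ### Subgroups of finite index -/

section FiniteIndex

variable {Γ Δ Θ : Type*} [Group Γ] [Group Δ] [Group Θ]

theorem finiteIndex_map (f : Γ →* Δ) [hf : f.range.FiniteIndex] (A : Subgroup Γ)
    [A.FiniteIndex] : (A.map f).FiniteIndex := by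
  have : (A ⊔ f.ker).FiniteIndex := Subgroup.finiteIndex_of_le (le_sup_left (a := A))
  refine ⟨?_⟩
  rw [Subgroup.index_map]
  exact mul_ne_zero this.index_ne_zero hf.index_ne_zero

instance finiteIndex_comap (f : Γ →* Δ) (A : Subgroup Δ) [A.FiniteIndex] :
    (A.comap f).FiniteIndex := by
  refine ⟨?_⟩
  rw [Subgroup.index_comap]
  exact Subgroup.FiniteIndex.index_ne_zero (H := A.subgroupOf f.range)

instance finiteIndex_prod (A : Subgroup Γ) (B : Subgroup Δ) [hA : A.FiniteIndex]
    [hB : B.FiniteIndex] : (A.prod B).FiniteIndex := by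
  refine ⟨?_⟩
  rw [Subgroup.index_prod]
  exact mul_ne_zero hA.index_ne_zero hB.index_ne_zero

theorem finiteIndex_pi {ι : Type*} [Finite ι] (D : ι → Subgroup Γ)
    (hD : ∀ i, (D i).FiniteIndex) : (Subgroup.pi Set.univ D).FiniteIndex := by
  have := Fintype.ofFinite ι
  refine ⟨?_⟩
  rw [Subgroup.index_pi]
  exact Finset.prod_ne_zero_iff.2 fun i _ => (hD i).index_ne_zero

theorem finiteIndex_range_of_surjective {f : Γ →* Δ} (hf : Function.Surjective f) :
    f.range.FiniteIndex := by
  rw [MonoidHom.range_eq_top.2 hf]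
  infer_instance

instance finiteIndex_range_comp (g : Δ →* Θ) (f : Γ →* Δ) [g.range.FiniteIndex]
    [f.range.FiniteIndex] : (g.comp f).range.FiniteIndex := by
  rw [← MonoidHom.map_range]
  exact finiteIndex_map g f.range

theorem range_subgroupComap (f : Γ →* Δ) (A : Subgroup Δ) :
    (f.subgroupComap A).range = f.range.subgroupOf A := by
  ext y
  exact ⟨fun ⟨h, hh⟩ => ⟨h, congrArg Subtype.val hh⟩,
    fun ⟨h, hh⟩ => ⟨⟨h, show f h ∈ A from hh ▸ y.2⟩, Subtype.ext hh⟩⟩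

instance finiteIndex_range_evalMonoidHom {ι : Type*} (i : ι) :
    (Pi.evalMonoidHom (fun _ => Γ) i).range.FiniteIndex :=
  finiteIndex_range_of_surjective fun g => ⟨fun _ => g, rfl⟩

instance finiteIndex_range_mulEquiv (e : Γ ≃* Δ) : e.toMonoidHom.range.FiniteIndex :=
  finiteIndex_range_of_surjective e.surjective

instance finiteIndex_range_subtype (A : Subgroup Γ) [A.FiniteIndex] :
    A.subtype.range.FiniteIndex := by
  rwa [Subgroup.range_subtype]

instance finiteIndex_range_inclusion {A B : Subgroup Γ} (h : A ≤ B) [A.FiniteIndex] :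
    (Subgroup.inclusion h).range.FiniteIndex := by
  rw [Subgroup.inclusion_range]
  infer_instance

instance finiteIndex_range_subgroupComap (f : Γ →* Δ) (A : Subgroup Δ) [f.range.FiniteIndex] :
    (f.subgroupComap A).range.FiniteIndex := by
  rw [range_subgroupComap]
  infer_instance

theorem finiteIndex_range_comp_subtype (f : Γ →* Δ) [f.range.FiniteIndex] {N C : Subgroup Γ}
    (hN : N ≤ f.ker) [(N ⊔ C).FiniteIndex] : (f.comp C.subtype).range.FiniteIndex := by
  have := finiteIndex_map f (N ⊔ C)
  rwa [Subgroup.map_sup, (N.map_eq_bot_iff).2 hN, bot_sup_eq, ← C.range_subtype,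
    MonoidHom.map_range] at this

end FiniteIndex

/-! ### Commensurability -/

namespace AbstractlyCommensurable

variable {H K L : Type*} [Group H] [Group K] [Group L]

theorem of_injective_of_injective {P : Type*} [Group P] {f : P →* H} {g : P →* K}
    (hf : Function.Injective f) (hg : Function.Injective g) [f.range.FiniteIndex]
    [g.range.FiniteIndex] : AbstractlyCommensurable H K :=
  ⟨f.range, g.range, inferInstance, inferInstance,
    ⟨(MonoidHom.ofInjective hf).symm.trans (MonoidHom.ofInjective hg)⟩⟩

theorem of_injective {f : H →* K} (hf : Function.Injective f) [f.range.FiniteIndex] :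
    AbstractlyCommensurable H K :=
  of_injective_of_injective (f := (MulEquiv.refl H).toMonoidHom) Function.injective_id hf

theorem of_mulEquiv (e : H ≃* K) : AbstractlyCommensurable H K :=
  of_injective (f := e.toMonoidHom) e.injective

theorem symm : AbstractlyCommensurable H K → AbstractlyCommensurable K H :=
  fun ⟨A, B, hA, hB, ⟨e⟩⟩ => ⟨B, A, hB, hA, ⟨e.symm⟩⟩

theorem of_subgroup (A : Subgroup H) [A.FiniteIndex] : AbstractlyCommensurable H A :=
  (of_injective A.subtype_injective).symm

theorem of_subgroupOf (N A : Subgroup H) [A.FiniteIndex] :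
    AbstractlyCommensurable (N.subgroupOf A) N := by
  let f : N.subgroupOf A →* N := A.subtype.subgroupComap N
  have hf : Function.Injective f :=
    fun _ _ h => Subtype.ext (Subtype.ext (congrArg Subtype.val h :))
  have : f.range.FiniteIndex := finiteIndex_range_subgroupComap A.subtype N
  exact of_injective hf

theorem trans (h : AbstractlyCommensurable H K) (h' : AbstractlyCommensurable K L) :
    AbstractlyCommensurable H L := by
  obtain ⟨A, B, hA, hB, ⟨e⟩⟩ := h
  obtain ⟨B', C, hB', hC, ⟨e'⟩⟩ := h'
  let f := (A.subtype.comp e.symm.toMonoidHom).comp (Subgroup.inclusion (inf_le_left (b := B')))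
  let g := (C.subtype.comp e'.toMonoidHom).comp (Subgroup.inclusion (inf_le_right (a := B)))
  have hf : Function.Injective f :=
    (A.subtype_injective.comp e.symm.injective).comp (Subgroup.inclusion_injective _)
  have hg : Function.Injective g :=
    (C.subtype_injective.comp e'.injective).comp (Subgroup.inclusion_injective _)
  exact of_injective_of_injective hf hg

theorem prod {H' K' : Type*} [Group H'] [Group K'] (h : AbstractlyCommensurable H K)
    (h' : AbstractlyCommensurable H' K') : AbstractlyCommensurable (H × H') (K × K') := by
  obtain ⟨A, B, hA, hB, ⟨e⟩⟩ := h
  obtain ⟨A', B', hA', hB', ⟨e'⟩⟩ := h'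
  exact ⟨A.prod A', B.prod B', inferInstance, inferInstance,
    ⟨(Subgroup.prodEquiv A A').trans ((MulEquiv.prodCongr e e').trans
      (Subgroup.prodEquiv B B').symm)⟩⟩

theorem finite_iff (h : AbstractlyCommensurable H K) : Finite H ↔ Finite K := by
  obtain ⟨A, B, hA, hB, ⟨e⟩⟩ := h
  rw [Subgroup.finite_iff_finite_and_finiteIndex A, Subgroup.finite_iff_finite_and_finiteIndex B,
    e.toEquiv.finite_iff]
  exact and_congr_right fun _ => iff_of_true hA hB

section DisjointKer

variable {q : H →* L} {N : Subgroup H}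

theorem of_disjoint_ker (hN : Disjoint N q.ker) [hfin : (N.map q).FiniteIndex] :
    AbstractlyCommensurable N L := by
  have : (q.comp N.subtype).range.FiniteIndex := by rwa [MonoidHom.range_comp, N.range_subtype]
  refine of_injective (f := q.comp N.subtype) ((injective_iff_map_eq_one _).2 fun h hh => ?_)
  exact Subtype.ext (Subgroup.disjoint_def.1 hN h.2 hh)

theorem prod_ker_of_disjoint_ker [hNn : N.Normal] (hN : Disjoint N q.ker)
    [hfin : (N.map q).FiniteIndex] : AbstractlyCommensurable H (N × q.ker) := by
  have hcomm (k : N) (c : q.ker) : Commute (N.subtype k) (q.ker.subtype c) :=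
    Subgroup.commute_of_normal_of_disjoint _ _ hNn inferInstance hN _ _ k.2 c.2
  have : (MonoidHom.noncommCoprod _ _ hcomm).range.FiniteIndex := by
    rw [MonoidHom.noncommCoprod_range, N.range_subtype, q.ker.range_subtype,
      ← Subgroup.comap_map_eq]
    infer_instance
  refine (of_injective (f := MonoidHom.noncommCoprod _ _ hcomm) ?_).symm
  rw [MonoidHom.noncommCoprod_injective, N.range_subtype, q.ker.range_subtype]
  exact ⟨N.subtype_injective, q.ker.subtype_injective, hN⟩

end DisjointKer

end AbstractlyCommensurable

namespace GuptaSidki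

open scoped commutatorElement

/-! ### The wreath recursion -/

/-- The tautological action of tree automorphisms on vertices. -/
instance : MulAction TreeAut Vertex where
  smul g v := g v
  one_smul _ := rfl
  mul_smul _ _ _ := rfl

instance : FaithfulSMul TreeAut Vertex := ⟨fun h => RelIso.ext h⟩

/-- The decomposition `g = (s 0, s 1, s 2) a ^ r` of a tree automorphism: `r` is the rotation of the
first level induced by `g` and `s` is its family of first-level sections. -/
def IsWreath (g : TreeAut) (r : Fin 3) (s : Fin 3 → TreeAut) : Prop :=
  g • ([] : Vertex) = [] ∧ ∀ (x : Fin 3) (w : Vertex), g • (x :: w : Vertex) = (x + r) :: s x • w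

theorem IsWreath.one : IsWreath 1 0 (fun _ => 1) :=
  ⟨rfl, fun x w => by simp⟩

theorem IsWreath.mul {g h : TreeAut} {r r' : Fin 3} {s s' : Fin 3 → TreeAut}
    (hg : IsWreath g r s) (hh : IsWreath h r' s') :
    IsWreath (g * h) (r + r') (fun x => s (x + r') * s' x) :=
  ⟨by rw [mul_smul, hh.1, hg.1],
    fun x w => by rw [mul_smul, hh.2, hg.2, mul_smul, add_assoc, add_comm r]⟩

theorem IsWreath.inv {g : TreeAut} {r : Fin 3} {s : Fin 3 → TreeAut} (hg : IsWreath g r s) :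
    IsWreath g⁻¹ (-r) (fun x => (s (x - r))⁻¹) :=
  ⟨inv_smul_eq_iff.2 hg.1.symm, fun x w => inv_smul_eq_iff.2 <| by
    rw [hg.2, ← sub_eq_add_neg, sub_add_cancel, smul_inv_smul]⟩

theorem IsWreath.ext {g h : TreeAut} {r : Fin 3} {s : Fin 3 → TreeAut} (hg : IsWreath g r s)
    (hh : IsWreath h r s) : g = h := by
  refine eq_of_smul_eq_smul (α := Vertex) fun u => ?_
  cases u with
  | nil => rw [hg.1, hh.1]
  | cons x w => rw [hg.2, hh.2]

theorem IsWreath.unique {g : TreeAut} {r r' : Fin 3} {s s' : Fin 3 → TreeAut}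
    (hg : IsWreath g r s) (hg' : IsWreath g r' s') : r = r' ∧ s = s' := by
  have h (x : Fin 3) (w : Vertex) : x + r = x + r' ∧ s x • w = s' x • w :=
    List.cons.inj <| by rw [← hg.2, hg'.2]
  exact ⟨add_left_cancel (h 0 []).1,
    funext fun x => eq_of_smul_eq_smul (α := Vertex) fun w => (h x w).2⟩

theorem isWreath_a : IsWreath a 1 (fun _ => 1) :=
  ⟨rfl, fun _ _ => rfl⟩

/-- The generator `a`, as an element of the Gupta–Sidki group. -/
def ga : G := ⟨a, Subgroup.subset_closure (by simp)⟩

/-- The generator `b`, as an element of the Gupta–Sidki group. -/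
def gb : G := ⟨b, Subgroup.subset_closure (by simp)⟩

theorem isWreath_gb : IsWreath gb 0 (fun x => (![ga, ga⁻¹, gb] x : G)) := by
  refine ⟨rfl, fun x w => ?_⟩
  fin_cases x <;> rfl

theorem exists_isWreath (g : G) : ∃ r, ∃ s : Fin 3 → G, IsWreath g r (fun x => s x) := by
  obtain ⟨g, hg⟩ := g
  induction hg using Subgroup.closure_induction with
  | mem x hx =>
    rcases hx with rfl | rfl
    · exact ⟨1, fun _ => 1, isWreath_a⟩
    · exact ⟨0, ![ga, ga⁻¹, gb], isWreath_gb⟩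
  | one => exact ⟨0, fun _ => 1, IsWreath.one⟩
  | mul x y hx hy ihx ihy =>
    obtain ⟨⟨r, s, h⟩, r', s', h'⟩ := And.intro ihx ihy
    exact ⟨_, fun x => s (x + r') * s' x, h.mul h'⟩
  | inv x hx ih =>
    obtain ⟨r, s, h⟩ := ih
    exact ⟨_, fun x => (s (x - r))⁻¹, h.inv⟩

/-- The rotation of the first level induced by an element of the Gupta–Sidki group; it is also the
exponent of `a` modulo `3` in any word representing the element. -/
noncomputable def rotation (g : G) : Fin 3 := (exists_isWreath g).choose

/-- The first-level sections of an element of the Gupta–Sidki group. -/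
noncomputable def sec (g : G) : Fin 3 → G := (exists_isWreath g).choose_spec.choose

theorem isWreath_rotation_sec (g : G) : IsWreath g (rotation g) (fun x => sec g x) :=
  (exists_isWreath g).choose_spec.choose_spec

theorem smul_nil (g : G) : g • ([] : Vertex) = [] := (isWreath_rotation_sec g).1

theorem smul_cons (g : G) (x : Fin 3) (v : Vertex) :
    g • (x :: v : Vertex) = (x + rotation g) :: sec g x • v := (isWreath_rotation_sec g).2 x v

section

variable {g : G} {r : Fin 3} {s : Fin 3 → G}

theorem IsWreath.rotation_eq (h : IsWreath g r (fun x => s x)) : rotation g = r :=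
  ((isWreath_rotation_sec g).unique h).1

theorem IsWreath.sec_eq (h : IsWreath g r (fun x => s x)) (x : Fin 3) : sec g x = s x :=
  Subtype.ext (congrFun ((isWreath_rotation_sec g).unique h).2 x)

end

theorem isWreath_mul (g h : G) : IsWreath (g * h : G) (rotation g + rotation h)
    (fun x => (sec g (x + rotation h) * sec h x : G)) :=
  (isWreath_rotation_sec g).mul (isWreath_rotation_sec h)

theorem isWreath_inv (g : G) :
    IsWreath (g⁻¹ : G) (-rotation g) (fun x => ((sec g (x - rotation g))⁻¹ : G)) :=
  (isWreath_rotation_sec g).inv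

@[simp] theorem rotation_mul (g h : G) : rotation (g * h) = rotation g + rotation h :=
  (isWreath_mul g h).rotation_eq

theorem sec_mul (g h : G) (x : Fin 3) : sec (g * h) x = sec g (x + rotation h) * sec h x :=
  (isWreath_mul g h).sec_eq x

@[simp] theorem rotation_one : rotation 1 = 0 :=
  IsWreath.rotation_eq (s := fun _ => 1) IsWreath.one

@[simp] theorem sec_one (x : Fin 3) : sec 1 x = 1 :=
  IsWreath.sec_eq (s := fun _ => 1) IsWreath.one x

@[simp] theorem rotation_inv (g : G) : rotation g⁻¹ = -rotation g := (isWreath_inv g).rotation_eq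

theorem sec_inv (g : G) (x : Fin 3) : sec g⁻¹ x = (sec g (x - rotation g))⁻¹ :=
  (isWreath_inv g).sec_eq x

theorem sec_conj (s : G) {g : G} (hg : rotation g = 0) (x : Fin 3) :
    sec (s * g * s⁻¹) (x + rotation s) = sec s x * sec g x * (sec s x)⁻¹ := by
  rw [sec_mul, sec_mul, sec_inv, rotation_inv, add_neg_cancel_right, hg, add_zero,
    add_sub_cancel_right]

theorem ext_sec {g h : G} (hr : rotation g = rotation h) (hs : ∀ x, sec g x = sec h x) :
    g = h := by
  have hg := isWreath_rotation_sec g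
  rw [hr, funext hs] at hg
  exact Subtype.ext (hg.ext (isWreath_rotation_sec h))

@[simp] theorem rotation_ga : rotation ga = 1 :=
  IsWreath.rotation_eq (s := fun _ => 1) isWreath_a

@[simp] theorem sec_ga (x : Fin 3) : sec ga x = 1 :=
  IsWreath.sec_eq (s := fun _ => 1) isWreath_a x

@[simp] theorem rotation_gb : rotation gb = 0 := isWreath_gb.rotation_eq

@[simp] theorem sec_gb_zero : sec gb 0 = ga := isWreath_gb.sec_eq 0

@[simp] theorem sec_gb_one : sec gb 1 = ga⁻¹ := isWreath_gb.sec_eq 1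

@[simp] theorem sec_gb_two : sec gb 2 = gb := isWreath_gb.sec_eq 2

theorem sec_gb_mem_zpowers_ga {x : Fin 3} (hx : x ≠ 2) : sec gb x ∈ Subgroup.zpowers ga := by
  fin_cases x
  · simp
  · simp
  · exact absurd rfl hx

/-! ### Level stabilizers and sections -/

/-- The pointwise stabilizer of the `n`-th level of the tree; levels `< n` are then fixed too, and
including them in the definition makes the family visibly antitone. -/
def levelStab (n : ℕ) : Subgroup G := fixingSubgroup G {v : Vertex | v.length ≤ n}

theorem mem_levelStab {n : ℕ} {g : G} :
    g ∈ levelStab n ↔ ∀ v : Vertex, v.length ≤ n → g • v = v := mem_fixingSubgroup_iff G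

theorem levelStab_antitone : Antitone levelStab := fun _ _ h =>
  fixingSubgroup_antitone G Vertex fun _ hv => le_trans hv h

theorem mem_levelStab_zero (g : G) : g ∈ levelStab 0 :=
  mem_levelStab.2 fun v hv => by rw [List.length_eq_zero_iff.1 (Nat.le_zero.1 hv), smul_nil]

theorem mem_levelStab_succ {n : ℕ} {g : G} :
    g ∈ levelStab (n + 1) ↔ rotation g = 0 ∧ ∀ x, sec g x ∈ levelStab n := by
  simp only [mem_levelStab]
  constructor
  · intro h
    have hcons (x : Fin 3) (v : Vertex) (hv : v.length ≤ n) :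
        x + rotation g = x ∧ sec g x • v = v :=
      List.cons.inj <| by rw [← smul_cons, h _ (by simpa using hv)]
    exact ⟨left_eq_add.1 (hcons 0 [] (Nat.zero_le n)).1.symm, fun x v hv => (hcons x v hv).2⟩
  · rintro ⟨hr, hs⟩ (_ | ⟨x, v⟩) hv
    · exact smul_nil g
    · rw [smul_cons, hr, add_zero, hs x v (by simpa using hv)]

theorem mem_levelStab_one {g : G} : g ∈ levelStab 1 ↔ rotation g = 0 := by
  simp [mem_levelStab_succ, mem_levelStab_zero]

/-- Taking the section at `x`, as a homomorphism on the first-level stabilizer. -/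
noncomputable def secHom (x : Fin 3) : levelStab 1 →* G where
  toFun g := sec g x
  map_one' := sec_one x
  map_mul' g h := by rw [Subgroup.coe_mul, sec_mul, mem_levelStab_one.1 h.2, add_zero]

@[simp] theorem secHom_apply (x : Fin 3) (g : levelStab 1) : secHom x g = sec g x := rfl

theorem sec_zpow {g : G} (hg : rotation g = 0) (k : ℤ) (x : Fin 3) :
    sec (g ^ k) x = sec g x ^ k :=
  map_zpow (secHom x) ⟨g, mem_levelStab_one.2 hg⟩ k

theorem sec_pow {g : G} (hg : rotation g = 0) (k : ℕ) (x : Fin 3) :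
    sec (g ^ k) x = sec g x ^ k :=
  map_pow (secHom x) ⟨g, mem_levelStab_one.2 hg⟩ k

theorem sec_mem_zpowers {g s : G} (hg : rotation g = 0) (hs : s ∈ Subgroup.zpowers g)
    (x : Fin 3) : sec s x ∈ Subgroup.zpowers (sec g x) := by
  obtain ⟨k, rfl⟩ := hs
  exact ⟨k, (sec_zpow hg k x).symm⟩

theorem rotation_eq_zero_of_mem_zpowers {g s : G} (hg : rotation g = 0)
    (hs : s ∈ Subgroup.zpowers g) : rotation s = 0 :=
  mem_levelStab_one.1 (Subgroup.zpowers_le.2 (mem_levelStab_one.2 hg) hs)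

theorem sec_eq_one_of_mem_zpowers_ga {s : G} (hs : s ∈ Subgroup.zpowers ga) (x : Fin 3) :
    sec s x = 1 := by
  obtain ⟨k, rfl⟩ := hs
  induction k generalizing x <;> simp_all [zpow_add_one, zpow_sub_one, sec_mul, sec_inv]

/-- The sections at `x` of the elements of `H` that fix the first level. -/
noncomputable def sectionSubgroup (H : Subgroup G) (x : Fin 3) : Subgroup G :=
  (H.subgroupOf (levelStab 1)).map (secHom x)

theorem mem_sectionSubgroup {H : Subgroup G} {x : Fin 3} {h : G} :
    h ∈ sectionSubgroup H x ↔ ∃ g ∈ H, rotation g = 0 ∧ sec g x = h := by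
  constructor
  · rintro ⟨⟨g, hr⟩, hg, rfl⟩
    exact ⟨g, hg, mem_levelStab_one.1 hr, rfl⟩
  · rintro ⟨g, hg, hr, rfl⟩
    exact ⟨⟨g, mem_levelStab_one.2 hr⟩, hg, rfl⟩

theorem sec_mem_sectionSubgroup {H : Subgroup G} {g : G} (hg : g ∈ H) (hr : rotation g = 0)
    (x : Fin 3) : sec g x ∈ sectionSubgroup H x :=
  mem_sectionSubgroup.2 ⟨g, hg, hr, rfl⟩

/-! ### The generators -/

theorem ga_pow_three : ga ^ 3 = 1 :=
  ext_sec (by simp [pow_succ]) (by simp [pow_succ, sec_mul])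

theorem gb_pow_three : gb ^ 3 = 1 := by
  suffices ∀ v : Vertex, gb ^ 3 • v = v from eq_of_smul_eq_smul fun v => by rw [this, one_smul]
  intro v
  induction v with
  | nil => exact smul_nil _
  | cons x v ih =>
    have hr : rotation (gb ^ 3) = 0 :=
      rotation_eq_zero_of_mem_zpowers rotation_gb (Subgroup.npow_mem_zpowers _ _)
    rw [smul_cons, hr, add_zero, sec_pow rotation_gb]
    fin_cases x
    · simp [ga_pow_three]
    · simp [ga_pow_three]
    · simpa using ih

theorem closure_ga_gb : Subgroup.closure {ga, gb} = (⊤ : Subgroup G) := by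
  have h : Subgroup.closure ((↑) ⁻¹' {a, b}) = (⊤ : Subgroup G) :=
    Subgroup.closure_closure_coe_preimage
  convert h using 2
  ext x
  simp only [Set.mem_insert_iff, Set.mem_singleton_iff, Set.mem_preimage, ga, gb, Subtype.ext_iff]

theorem eq_top_of_ga_gb_mem {H : Subgroup G} (ha : ga ∈ H) (hb : gb ∈ H) : H = ⊤ := by
  rw [eq_top_iff, ← closure_ga_gb, Subgroup.closure_le]
  exact Set.insert_subset ha (Set.singleton_subset_iff.2 hb)

theorem induction_left {P : G → Prop} (one : P 1) (ga_mul : ∀ g, P g → P (ga * g))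
    (gb_mul : ∀ g, P g → P (gb * g)) (g : G) : P g := by
  have hinv {c : G} (hc : c ^ 3 = 1) : c⁻¹ = c * c :=
    inv_eq_of_mul_eq_one_right (by rw [← hc, pow_succ, pow_two, mul_assoc])
  have hg : g ∈ Subgroup.closure {ga, gb} := closure_ga_gb ▸ Subgroup.mem_top g
  induction hg using Subgroup.closure_induction_left with
  | one => exact one
  | mul_left x hx y _ ih =>
    rcases hx with rfl | rfl
    exacts [ga_mul _ ih, gb_mul _ ih]
  | inv_mul_cancel x hx y _ ih =>
    rcases hx with rfl | rfl
    · rw [hinv ga_pow_three, mul_assoc]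
      exact ga_mul _ (ga_mul _ ih)
    · rw [hinv gb_pow_three, mul_assoc]
      exact gb_mul _ (gb_mul _ ih)

/-! ### The exponent of `b` and the abelianization -/

theorem sum_comp_add_right {A M : Type*} [AddGroup A] [Fintype A] [AddCommMonoid M] (f : A → M)
    (r : A) : ∑ x, f (x + r) = ∑ x, f x :=
  Equiv.sum_comp (Equiv.addRight r) f

theorem sum_rotation_sec (g : G) : ∑ x, rotation (sec g x) = 0 := by
  induction g using induction_left with
  | one => simp
  | ga_mul g ih => simpa [sec_mul] using ih
  | gb_mul g ih =>
    simp only [sec_mul, rotation_mul, Finset.sum_add_distrib, ih, add_zero]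
    rw [sum_comp_add_right fun x => rotation (sec gb x)]
    simp [Fin.sum_univ_three]

/-- The exponent of `b` modulo `3` in any word representing an element of the Gupta–Sidki group.
It is read off the tree as the common difference of the rotations of consecutive sections. -/
noncomputable def exponentB (g : G) : Fin 3 := rotation (sec g 2) - rotation (sec g 1)

theorem rotation_sec_add_one_sub (g : G) (x : Fin 3) :
    rotation (sec g (x + 1)) - rotation (sec g x) = exponentB g := by
  have h := sum_rotation_sec g
  rw [Fin.sum_univ_three] at h
  have key : ∀ s t u : Fin 3, s + t + u = 0 → t - s = u - t ∧ s - u = u - t := by decide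
  fin_cases x
  · exact (key _ _ _ h).1
  · rfl
  · exact (key _ _ _ h).2

@[simp] theorem exponentB_mul (g h : G) : exponentB (g * h) = exponentB g + exponentB h := by
  rw [← rotation_sec_add_one_sub g (1 + rotation h), exponentB, exponentB, sec_mul, sec_mul,
    rotation_mul, rotation_mul,
    show (1 + rotation h + 1 : Fin 3) = 2 + rotation h by rw [add_right_comm]; rfl]
  abel

@[simp] theorem exponentB_one : exponentB 1 = 0 := by simp [exponentB]

@[simp] theorem exponentB_ga : exponentB ga = 0 := by simp [exponentB]

@[simp] theorem exponentB_gb : exponentB gb = 1 := by simp [exponentB]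

/-- `rotation` as a homomorphism. -/
noncomputable def rotationHom : G →* Multiplicative (Fin 3) where
  toFun g := Multiplicative.ofAdd (rotation g)
  map_one' := by simp
  map_mul' g h := by simp

/-- `exponentB` as a homomorphism. -/
noncomputable def exponentBHom : G →* Multiplicative (Fin 3) where
  toFun g := Multiplicative.ofAdd (exponentB g)
  map_one' := by simp
  map_mul' g h := by simp

@[simp] theorem exponentB_inv (g : G) : exponentB g⁻¹ = -exponentB g :=
  map_inv exponentBHom g

theorem sum_exponentB_sec (g : G) : ∑ x, exponentB (sec g x) = exponentB g := by
  induction g using induction_left with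
  | one => simp
  | ga_mul g ih => simpa [sec_mul] using ih
  | gb_mul g ih =>
    simp only [sec_mul, exponentB_mul, Finset.sum_add_distrib, ih]
    rw [sum_comp_add_right fun x => exponentB (sec gb x)]
    simp [Fin.sum_univ_three]

theorem rotation_sec (g : G) (x : Fin 3) :
    rotation (sec g x) = exponentB (sec g (x + 2)) - exponentB (sec g (x + 1)) := by
  induction g using induction_left with
  | one => simp
  | ga_mul g ih => simpa [sec_mul] using ih
  | gb_mul g ih =>
    have hgb (y : Fin 3) : rotation (sec gb y) =
        exponentB (sec gb (y + 2)) - exponentB (sec gb (y + 1)) := by fin_cases y <;> simp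
    simp only [sec_mul, rotation_mul, exponentB_mul, ih, hgb, add_right_comm x]
    abel

theorem pow_val_add {M : Type*} [Monoid M] {n : ℕ} [NeZero n] {c : M} (hc : c ^ n = 1)
    (x y : Fin n) : c ^ (x + y).val = c ^ x.val * c ^ y.val := by
  rw [Fin.val_add, ← pow_add, ← pow_eq_pow_mod _ hc]

theorem abelianization_of_eq (g : G) : Abelianization.of g =
    Abelianization.of ga ^ (rotation g).val * Abelianization.of gb ^ (exponentB g).val := by
  have ha : Abelianization.of ga ^ 3 = 1 := by rw [← map_pow, ga_pow_three, map_one]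
  have hb : Abelianization.of gb ^ 3 = 1 := by rw [← map_pow, gb_pow_three, map_one]
  induction g using induction_left with
  | one => simp
  | ga_mul g ih => simp [ih, pow_val_add ha, mul_assoc]
  | gb_mul g ih => simp [ih, pow_val_add hb, mul_left_comm]

theorem mem_commutator_iff {g : G} : g ∈ commutator G ↔ rotation g = 0 ∧ exponentB g = 0 := by
  refine ⟨fun hg => ⟨Abelianization.commutator_subset_ker rotationHom hg,
    Abelianization.commutator_subset_ker exponentBHom hg⟩, fun ⟨hr, hb⟩ => ?_⟩
  rw [← Abelianization.ker_of, MonoidHom.mem_ker, abelianization_of_eq, hr, hb]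
  simp

theorem levelStab_two_le_commutator : levelStab 2 ≤ commutator G := fun g hg => by
  obtain ⟨hr, hs⟩ := mem_levelStab_succ.1 hg
  rw [mem_commutator_iff, exponentB, mem_levelStab_one.1 (hs 2), mem_levelStab_one.1 (hs 1)]
  exact ⟨hr, sub_zero 0⟩

instance finiteIndex_commutator : (commutator G).FiniteIndex := by
  have : Finite (Multiplicative (Fin 3)) := inferInstanceAs (Finite (Fin 3))
  have : commutator G = rotationHom.ker ⊓ exponentBHom.ker :=
    Subgroup.ext fun g => mem_commutator_iff
  rw [this]
  infer_instance

theorem eq_top_of_commutator_le {P : Subgroup G} (hP : commutator G ≤ P) {p q : G} (hp : p ∈ P)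
    (hpr : rotation p = 1) (hpb : exponentB p = 0) (hq : q ∈ P) (hqr : rotation q = 0)
    (hqb : exponentB q = 1) : P = ⊤ := by
  have ha : p * ga⁻¹ ∈ P := hP (mem_commutator_iff.2 (by simp [hpr, hpb]))
  have hb : q * gb⁻¹ ∈ P := hP (mem_commutator_iff.2 (by simp [hqr, hqb]))
  exact eq_top_of_ga_gb_mem (inv_mem_iff.1 ((Subgroup.mul_mem_cancel_left P hp).1 ha))
    (inv_mem_iff.1 ((Subgroup.mul_mem_cancel_left P hq).1 hb))

/-! ### Conjugates of `b` -/

@[simp] theorem rotation_ga_pow (x : Fin 3) : rotation (ga ^ x.val) = x := by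
  fin_cases x <;> simp [pow_succ]

@[simp] theorem sec_ga_pow (n : ℕ) (x : Fin 3) : sec (ga ^ n) x = 1 :=
  sec_eq_one_of_mem_zpowers_ga (Subgroup.npow_mem_zpowers _ _) x

/-- The conjugate `b_x = a ^ x b a ^ (-x)`; the three of them generate the first-level stabilizer,
and the sections of `b_x` are those of `b` shifted cyclically by `x`. -/
def conjB (x : Fin 3) : G := ga ^ x.val * gb * (ga ^ x.val)⁻¹

@[simp] theorem rotation_conjB (x : Fin 3) : rotation (conjB x) = 0 := by simp [conjB]

@[simp] theorem exponentB_conjB (x : Fin 3) : exponentB (conjB x) = 1 := by simp [conjB]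

@[simp] theorem sec_conjB (x y : Fin 3) : sec (conjB x) y = sec gb (y - x) := by
  have := sec_conj (ga ^ x.val) rotation_gb (y - x)
  rwa [rotation_ga_pow, sub_add_cancel, sec_ga_pow, one_mul, inv_one, mul_one] at this

theorem sectionSubgroup_top (x : Fin 3) : sectionSubgroup ⊤ x = ⊤ := by
  have hb (y : Fin 3) : sec gb y ∈ sectionSubgroup ⊤ x := by
    simpa using sec_mem_sectionSubgroup (Subgroup.mem_top _) (rotation_conjB (x - y)) x
  exact eq_top_of_ga_gb_mem (by simpa using hb 0) (by simpa using hb 2)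

theorem exists_rotation_eq_zero_sec_eq (x : Fin 3) (g : G) :
    ∃ h, rotation h = 0 ∧ sec h x = g := by
  have hg : g ∈ sectionSubgroup ⊤ x := by rw [sectionSubgroup_top]; trivial
  obtain ⟨h, -, hh⟩ := mem_sectionSubgroup.1 hg
  exact ⟨h, hh⟩

/-! ### Sections at words -/

/-- The section of an element at a vertex of the tree. -/
noncomputable def secWord : G → Vertex → G
  | g, [] => g
  | g, x :: v => secWord (sec g x) v

@[simp] theorem secWord_nil (g : G) : secWord g [] = g := rfl

@[simp] theorem secWord_cons (g : G) (x : Fin 3) (v : Vertex) :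
    secWord g (x :: v) = secWord (sec g x) v := rfl

@[simp] theorem length_smul (g : G) (v : Vertex) : (g • v).length = v.length := by
  induction v generalizing g with
  | nil => rw [smul_nil]
  | cons x v ih => rw [smul_cons, List.length_cons, List.length_cons, ih]

theorem smul_append (g : G) (u v : Vertex) :
    g • (u ++ v : Vertex) = g • u ++ secWord g u • v := by
  induction u generalizing g with
  | nil => rw [smul_nil]; rfl
  | cons x u ih => rw [List.cons_append, smul_cons, ih, smul_cons]; rfl

theorem secWord_mul (g h : G) (v : Vertex) :
    secWord (g * h) v = secWord g (h • v) * secWord h v := by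
  induction v generalizing g h with
  | nil => rw [smul_nil]; rfl
  | cons x v ih => rw [smul_cons, secWord_cons, sec_mul, ih, secWord_cons, secWord_cons]

@[simp] theorem secWord_one (v : Vertex) : secWord 1 v = 1 := by
  induction v with
  | nil => rfl
  | cons x v ih => rw [secWord_cons, sec_one, ih]

theorem secWord_conj (s : G) {g : G} {v : Vertex} (hg : g • v = v) :
    secWord (s * g * s⁻¹) (s • v) = secWord s v * secWord g v * (secWord s v)⁻¹ := by
  have h := secWord_mul (s * g * s⁻¹) s v
  rw [inv_mul_cancel_right, secWord_mul, hg] at h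
  exact eq_mul_inv_of_mul_eq h.symm

theorem secWord_inv {g : G} {v : Vertex} (hg : g • v = v) : secWord g⁻¹ v = (secWord g v)⁻¹ := by
  have h := secWord_mul g⁻¹ g v
  rw [inv_mul_cancel, secWord_one, hg] at h
  exact eq_inv_of_mul_eq_one_left h.symm

theorem smul_eq_of_mem_levelStab {n : ℕ} {g : G} (hg : g ∈ levelStab n) {v : Vertex}
    (hv : v.length ≤ n) : g • v = v := mem_levelStab.1 hg v hv

instance levelStab_normal (n : ℕ) : (levelStab n).Normal :=
  ⟨fun g hg s => mem_levelStab.2 fun v hv => by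
    rw [mul_smul, mul_smul, smul_eq_of_mem_levelStab hg (by simpa using hv), smul_inv_smul]⟩

theorem mem_levelStab_add {k m : ℕ} {g : G} : g ∈ levelStab (k + m) ↔
    g ∈ levelStab k ∧ ∀ v : Vertex, v.length = k → secWord g v ∈ levelStab m := by
  induction k generalizing g with
  | zero => simp [mem_levelStab_zero, List.length_eq_zero_iff]
  | succ k ih =>
    simp only [add_right_comm k 1 m, mem_levelStab_succ, ih, forall_and, and_assoc]
    refine and_congr_right fun _ => and_congr_right fun _ => ⟨?_, fun h x v hv => ?_⟩
    · rintro h (_ | ⟨x, v⟩) hv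
      · simp at hv
      · exact h x v (by simpa using hv)
    · exact h (x :: v) (by simpa using hv)

theorem exists_smul_ne {g : G} (hg : g ≠ 1) : ∃ v : Vertex, g • v ≠ v := by
  contrapose! hg
  exact eq_of_smul_eq_smul fun v : Vertex => by rw [hg, one_smul]

/-- The sections at the vertices of the `n`-th level, as a homomorphism on its stabilizer. -/
noncomputable def sections (n : ℕ) : levelStab n →* (List.Vector (Fin 3) n → G) where
  toFun g v := secWord g v.1
  map_one' := funext fun v => secWord_one _
  map_mul' g h := funext fun v => by
    rw [Subgroup.coe_mul, secWord_mul, smul_eq_of_mem_levelStab h.2 v.2.le]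
    rfl

/-- The section at a vertex of the `n`-th level, as a homomorphism on the stabilizer of this
level. -/
noncomputable def sectionAt {n : ℕ} (v : List.Vector (Fin 3) n) : levelStab n →* G :=
  (Pi.evalMonoidHom (fun _ => G) v).comp (sections n)

theorem sections_injective (n : ℕ) : Function.Injective (sections n) := by
  refine (injective_iff_map_eq_one _).2 fun g hg => Subtype.ext ?_
  refine eq_of_smul_eq_smul fun v : Vertex => ?_
  rcases le_total v.length n with hv | hv
  · rw [smul_eq_of_mem_levelStab g.2 hv, Subgroup.coe_one, one_smul]
  · have hu : (v.take n).length = n := List.length_take_of_le hv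
    rw [← List.take_append_drop n v, smul_append, smul_eq_of_mem_levelStab g.2 hu.le,
      show secWord g (v.take n) = 1 from congrFun hg ⟨_, hu⟩, Subgroup.coe_one, one_smul, one_smul]

theorem exists_smul_eq_secWord_eq {u v : Vertex} (h : u.length = v.length) (g : G) :
    ∃ s : G, s • u = v ∧ secWord s u = g := by
  induction u generalizing v with
  | nil => exact ⟨g, by rw [smul_nil, List.length_eq_zero_iff.1 h.symm], rfl⟩
  | cons x u ih =>
    obtain _ | ⟨y, v⟩ := v
    · simp at h
    obtain ⟨s, hs, hsec⟩ := ih (by simpa using h)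
    obtain ⟨k, hk, hkx⟩ := exists_rotation_eq_zero_sec_eq x s
    refine ⟨ga ^ (y - x).val * k, ?_, ?_⟩
    · simp [smul_cons, sec_mul, hk, hkx, hs]
    · simp [sec_mul, hk, hkx, hsec]

/-! ### Copies and the branch structure -/

/-- The element `η` acts on the subtree at `v` as `ξ` acts on the whole tree, and fixes every vertex
outside that subtree. -/
def IsCopyAt (v : Vertex) (ξ η : G) : Prop :=
  η ∈ levelStab v.length ∧
    ∀ u : Vertex, u.length = v.length → secWord η u = if u = v then ξ else 1

section

variable {v : Vertex} {ξ η ξ' η' : G}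

theorem IsCopyAt.secWord_eq (h : IsCopyAt v ξ η) : secWord η v = ξ := by rw [h.2 v rfl, if_pos rfl]

theorem isCopyAt_nil (ξ : G) : IsCopyAt [] ξ ξ :=
  ⟨mem_levelStab_zero ξ, fun u hu => by rw [List.length_eq_zero_iff.1 hu]; rfl⟩

theorem isCopyAt_singleton_iff {x : Fin 3} :
    IsCopyAt [x] ξ η ↔ rotation η = 0 ∧ ∀ y, sec η y = if y = x then ξ else 1 := by
  refine and_congr mem_levelStab_one ⟨fun h y => ?_, fun h u hu => ?_⟩
  · simpa using h [y] rfl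
  · obtain ⟨y, rfl⟩ := List.length_eq_one_iff.1 hu
    simpa using h y

theorem IsCopyAt.cons {x : Fin 3} {ζ : G} (h : IsCopyAt v ξ η) (hζ : IsCopyAt [x] η ζ) :
    IsCopyAt (x :: v) ξ ζ := by
  obtain ⟨hr, hs⟩ := isCopyAt_singleton_iff.1 hζ
  refine ⟨mem_levelStab_succ.2 ⟨hr, fun y => ?_⟩, ?_⟩
  · rw [hs]
    split_ifs
    exacts [h.1, one_mem _]
  · rintro (_ | ⟨y, u⟩) hu
    · simp at hu
    · rw [secWord_cons, hs]
      by_cases hy : y = x <;> simp [hy, h.2 u (Nat.succ_injective hu)]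

theorem isCopyAt_one (v : Vertex) : IsCopyAt v 1 1 :=
  ⟨one_mem _, fun u _ => by rw [secWord_one, ite_self]⟩

theorem IsCopyAt.mul (h : IsCopyAt v ξ η) (h' : IsCopyAt v ξ' η') :
    IsCopyAt v (ξ * ξ') (η * η') := by
  refine ⟨mul_mem h.1 h'.1, fun u hu => ?_⟩
  rw [secWord_mul, smul_eq_of_mem_levelStab h'.1 hu.le, h.2 u hu, h'.2 u hu]
  split_ifs
  exacts [rfl, one_mul 1]

theorem IsCopyAt.inv (h : IsCopyAt v ξ η) : IsCopyAt v ξ⁻¹ η⁻¹ := by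
  refine ⟨inv_mem h.1, fun u hu => ?_⟩
  rw [secWord_inv (smul_eq_of_mem_levelStab h.1 hu.le), h.2 u hu]
  split_ifs
  exacts [rfl, inv_one]

theorem IsCopyAt.commutatorElement (h : IsCopyAt v ξ η) (h' : IsCopyAt v ξ' η') :
    IsCopyAt v ⁅ξ, ξ'⁆ ⁅η, η'⁆ :=
  ((h.mul h').mul h.inv).mul h'.inv

theorem IsCopyAt.conj (h : IsCopyAt v ξ η) (s : G) :
    IsCopyAt (s • v) (secWord s v * ξ * (secWord s v)⁻¹) (s * η * s⁻¹) := by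
  refine ⟨?_, fun u hu => ?_⟩
  · rw [length_smul]
    exact (levelStab_normal _).conj_mem _ h.1 s
  · obtain ⟨w, rfl⟩ : ∃ w, u = s • w := ⟨s⁻¹ • u, (smul_inv_smul s u).symm⟩
    have hw : w.length = v.length := by simpa using hu
    rw [secWord_conj s (smul_eq_of_mem_levelStab h.1 hw.le), h.2 w hw]
    by_cases hwv : w = v
    · simp [hwv]
    · simp [hwv]

theorem IsCopyAt.sections_eq {n : ℕ} {v : List.Vector (Fin 3) n} (h : IsCopyAt v.1 ξ η)
    (hη : η ∈ levelStab n) : sections n ⟨η, hη⟩ = Pi.mulSingle v ξ := by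
  funext u
  rw [Pi.mulSingle_apply]
  exact (h.2 u.1 (u.2.trans v.2.symm)).trans (if_congr Subtype.ext_iff.symm rfl rfl)

theorem IsCopyAt.commute {u : Vertex} (h : IsCopyAt u ξ η) (h' : IsCopyAt v ξ' η')
    (hlen : u.length = v.length) (huv : u ≠ v) : Commute η η' := by
  have hη' : η' ∈ levelStab u.length := hlen ▸ h'.1
  have hsec : Commute (sections u.length ⟨η, h.1⟩) (sections u.length ⟨η', hη'⟩) := by
    rw [h.sections_eq (v := ⟨u, rfl⟩) h.1, h'.sections_eq (v := ⟨v, hlen.symm⟩) hη']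
    exact Pi.mulSingle_commute (fun h => huv (congrArg Subtype.val h)) _ _
  exact (hsec.of_map (sections_injective _)).map (levelStab u.length).subtype

end

/-- The elements of `G` whose copy at `v` exists and lies in `N`. For normal `N` this is, up to the
identification of the subtree at `v` with the tree, the rigid vertex stabilizer of `N`. -/
def rigidSection (N : Subgroup G) (v : Vertex) : Subgroup G where
  carrier := {ξ | ∃ η ∈ N, IsCopyAt v ξ η}
  one_mem' := ⟨1, one_mem N, isCopyAt_one v⟩
  mul_mem' := fun ⟨η, hη, h⟩ ⟨η', hη', h'⟩ => ⟨η * η', mul_mem hη hη', h.mul h'⟩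
  inv_mem' := fun ⟨η, hη, h⟩ => ⟨η⁻¹, inv_mem hη, h.inv⟩

theorem rigidSection_mono {M N : Subgroup G} (h : M ≤ N) (v : Vertex) :
    rigidSection M v ≤ rigidSection N v := fun _ ⟨η, hη, hc⟩ => ⟨η, h hη, hc⟩

theorem rigidSection_rigidSection_le (N : Subgroup G) (x : Fin 3) (v : Vertex) :
    rigidSection (rigidSection N [x]) v ≤ rigidSection N (x :: v) :=
  fun _ ⟨_, ⟨ζ, hζ, hx⟩, hv⟩ => ⟨ζ, hζ, hv.cons hx⟩

theorem conj_mem_rigidSection {N : Subgroup G} [hN : N.Normal] {u : Vertex} {ξ : G}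
    (hξ : ξ ∈ rigidSection N u) (s : G) :
    secWord s u * ξ * (secWord s u)⁻¹ ∈ rigidSection N (s • u) :=
  let ⟨η, hη, h⟩ := hξ
  ⟨s * η * s⁻¹, hN.conj_mem η hη s, h.conj s⟩

theorem rigidSection_le_of_length_eq (N : Subgroup G) [N.Normal] {u v : Vertex}
    (h : u.length = v.length) : rigidSection N u ≤ rigidSection N v := fun ξ hξ => by
  obtain ⟨s, rfl, hs⟩ := exists_smul_eq_secWord_eq h 1
  simpa [hs] using conj_mem_rigidSection hξ s

instance rigidSection_normal (N : Subgroup G) [N.Normal] (v : Vertex) :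
    (rigidSection N v).Normal := by
  refine ⟨fun ξ hξ g => ?_⟩
  obtain ⟨s, hv, rfl⟩ := exists_smul_eq_secWord_eq (rfl : v.length = v.length) g
  simpa only [hv] using conj_mem_rigidSection hξ s

theorem levelStab_add_le {N : Subgroup G} {n m : ℕ}
    (h : ∀ v : Vertex, v.length = n → levelStab m ≤ rigidSection N v) : levelStab (n + m) ≤ N := by
  intro g hg
  obtain ⟨hgn, hgm⟩ := mem_levelStab_add.1 hg
  have hmem : sections n ⟨g, hgn⟩ ∈ (N.subgroupOf (levelStab n)).map (sections n) := by
    refine Subgroup.pi_mem_of_mulSingle_mem _ fun v => ?_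
    obtain ⟨η, hη, hc⟩ := h v.1 v.2 (hgm v.1 v.2)
    have hηn : η ∈ levelStab n := by simpa only [v.2] using hc.1
    exact ⟨⟨η, hηn⟩, hη, hc.sections_eq hηn⟩
  obtain ⟨η, hη, heq⟩ := hmem
  rw [sections_injective n heq] at hη
  exact hη

theorem closure_ga_mul_gb_gb_mul_ga_inv :
    Subgroup.closure {ga * gb, gb * ga⁻¹} = (⊤ : Subgroup G) := by
  set P := Subgroup.closure {ga * gb, gb * ga⁻¹}
  have hu : ga * gb ∈ P := Subgroup.subset_closure (by simp)
  have hv : gb * ga⁻¹ ∈ P := Subgroup.subset_closure (by simp)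
  have hbb : gb * gb = gb⁻¹ := eq_inv_of_mul_eq_one_left gb_pow_three
  have hconj : ga * gb * ga⁻¹ = (ga * gb * (gb * ga⁻¹))⁻¹ := by
    rw [mul_assoc ga gb (gb * ga⁻¹), ← mul_assoc gb, hbb]
    group
  have ha : ga ∈ P := by
    have : ga * gb * ga⁻¹ * (gb * ga⁻¹)⁻¹ ∈ P :=
      mul_mem (hconj ▸ inv_mem (mul_mem hu hv)) (inv_mem hv)
    simpa [mul_assoc] using this
  exact eq_top_of_ga_gb_mem ha ((Subgroup.mul_mem_cancel_left P ha).1 hu)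

theorem isCopyAt_commutatorElement_conjB :
    IsCopyAt [0] ⁅ga * gb, gb * ga⁻¹⁆ ⁅conjB 0 * conjB 1, conjB 1 * conjB 2⁆ := by
  refine isCopyAt_singleton_iff.2 ⟨by simp [commutatorElement_def], fun y => ?_⟩
  have h1 : (-1 : Fin 3) = 2 := rfl
  have h2 : (-2 : Fin 3) = 1 := rfl
  fin_cases y <;> simp [commutatorElement_def, sec_mul, sec_inv, h1, h2, mul_assoc]

theorem commutator_le_rigidSection_singleton (x : Fin 3) :
    commutator G ≤ rigidSection ⁅levelStab 1, levelStab 1⁆ [x] := by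
  refine le_trans ?_ (rigidSection_le_of_length_eq _ (rfl : [(0 : Fin 3)].length = [x].length))
  have hmem (k l : Fin 3) : conjB k * conjB l ∈ levelStab 1 := by simp [mem_levelStab_one]
  have huv : ⁅ga * gb, gb * ga⁻¹⁆ ∈ rigidSection ⁅levelStab 1, levelStab 1⁆ [0] :=
    ⟨_, Subgroup.commutator_mem_commutator (hmem 0 1) (hmem 1 2),
      isCopyAt_commutatorElement_conjB⟩
  refine commutator_le_of_closure_eq_top closure_ga_mul_gb_gb_mul_ga_inv ?_
  rintro _ (rfl | rfl) _ (rfl | rfl)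
  · rw [commutatorElement_self]; exact one_mem _
  · exact huv
  · rw [← commutatorElement_inv]; exact inv_mem huv
  · rw [commutatorElement_self]; exact one_mem _

theorem exists_eq_gb_pow_mul {g : G} (hg : rotation g = 0) :
    ∃ k : ℕ, ∃ c ∈ commutator G, g = gb ^ k * c := by
  have hr : rotation (gb ^ (exponentB g).val) = 0 :=
    rotation_eq_zero_of_mem_zpowers rotation_gb (Subgroup.npow_mem_zpowers _ _)
  have hb (x : Fin 3) : exponentB (gb ^ x.val) = x := by fin_cases x <;> simp [pow_succ]
  refine ⟨(exponentB g).val, (gb ^ (exponentB g).val)⁻¹ * g, mem_commutator_iff.2 ?_,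
    (mul_inv_cancel_left _ _).symm⟩
  simp [hr, hb, hg]

theorem commutator_levelStab_one_le : ⁅levelStab 1, levelStab 1⁆ ≤ ⁅commutator G, ⊤⁆ := by
  let π := QuotientGroup.mk' ⁅commutator G, (⊤ : Subgroup G)⁆
  have hcommute {g h : G} : Commute (π g) (π h) ↔ ⁅g, h⁆ ∈ ⁅commutator G, (⊤ : Subgroup G)⁆ := by
    rw [← commutatorElement_eq_one_iff_commute, ← map_commutatorElement]
    exact QuotientGroup.eq_one_iff _
  have hcentral {c : G} (hc : c ∈ commutator G) (g : G) : Commute (π c) (π g) :=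
    hcommute.2 (Subgroup.commutator_mem_commutator hc (Subgroup.mem_top g))
  rw [Subgroup.commutator_le]
  intro g hg h hh
  obtain ⟨k, c, hc, rfl⟩ := exists_eq_gb_pow_mul (mem_levelStab_one.1 hg)
  obtain ⟨l, d, hd, rfl⟩ := exists_eq_gb_pow_mul (mem_levelStab_one.1 hh)
  refine hcommute.1 ?_
  have hkl : Commute (π (gb ^ k)) (π (gb ^ l)) := (Commute.pow_pow_self gb k l).map π
  have hl : Commute (π (gb ^ k)) (π (gb ^ l * d)) := by
    rw [map_mul]
    exact hkl.mul_right (hcentral hd _).symm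
  rw [map_mul π (gb ^ k)]
  exact hl.mul_left (hcentral hc _)

theorem sectionSubgroup_commutator_zero : sectionSubgroup (commutator G) 0 = ⊤ := by
  have hmem (k l : Fin 3) : sec gb (-k) * (sec gb (-l))⁻¹ ∈ sectionSubgroup (commutator G) 0 := by
    refine mem_sectionSubgroup.2 ⟨conjB k * (conjB l)⁻¹, mem_commutator_iff.2 ?_, ?_, ?_⟩ <;>
      simp [sec_mul, sec_inv]
  have h1 : (-1 : Fin 3) = 2 := rfl
  have h2 : (-2 : Fin 3) = 1 := rfl
  have huv : gb * ga⁻¹ ∈ sectionSubgroup (commutator G) 0 := by simpa [h1] using hmem 1 0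
  have hvw : ga⁻¹ * gb⁻¹ ∈ sectionSubgroup (commutator G) 0 := by
    simpa [h1, h2] using hmem 2 1
  have haaa : ga⁻¹ * (ga⁻¹ * ga⁻¹) = 1 := by
    rw [← mul_inv_rev, ← mul_inv_rev, mul_assoc, inv_eq_one]
    exact ga_pow_three
  have hb : gb ∈ sectionSubgroup (commutator G) 0 := by
    have := mul_mem (mul_mem huv hvw) huv
    simpa [mul_assoc, haaa] using this
  exact eq_top_of_ga_gb_mem (inv_mem_iff.1 ((Subgroup.mul_mem_cancel_left _ hb).1 huv)) hb

theorem commutator_top_le_rigidSection (x : Fin 3) :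
    ⁅commutator G, ⊤⁆ ≤ rigidSection ⁅commutator G, commutator G⁆ [x] := by
  refine le_trans ?_ (rigidSection_le_of_length_eq _ (rfl : [(0 : Fin 3)].length = [x].length))
  rw [Subgroup.commutator_le]
  intro ξ hξ g _
  obtain ⟨η, hη, hc⟩ := commutator_le_rigidSection_singleton 0 hξ
  have hg : g ∈ sectionSubgroup (commutator G) 0 := by
    rw [sectionSubgroup_commutator_zero]; trivial
  obtain ⟨t, ht, htr, rfl⟩ := mem_sectionSubgroup.1 hg
  obtain ⟨hr, hs⟩ := isCopyAt_singleton_iff.1 hc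
  refine ⟨⁅η, t⁆, Subgroup.commutator_mem_commutator
    (Subgroup.commutator_mono le_top le_top hη) ht, isCopyAt_singleton_iff.2 ⟨?_, fun y => ?_⟩⟩
  · simp [commutatorElement_def]
  · by_cases hy : y = 0 <;> simp [commutatorElement_def, sec_mul, sec_inv, hr, htr, hs, hy]

/-- The Gupta–Sidki group is regular branch over its commutator subgroup. -/
theorem commutator_le_rigidSection (v : Vertex) :
    commutator G ≤ rigidSection (commutator G) v := by
  induction v with
  | nil => exact fun ξ hξ => ⟨ξ, hξ, isCopyAt_nil ξ⟩
  | cons x v ih =>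
    have hx : commutator G ≤ rigidSection (commutator G) [x] :=
      (commutator_le_rigidSection_singleton x).trans
        (rigidSection_mono (Subgroup.commutator_mono le_top le_top) _)
    exact (ih.trans (rigidSection_mono hx v)).trans (rigidSection_rigidSection_le _ x v)

theorem levelStab_four_le : levelStab 4 ≤ ⁅commutator G, commutator G⁆ := by
  refine levelStab_add_le (n := 2) (m := 2) fun v hv => levelStab_two_le_commutator.trans ?_
  obtain ⟨x, y, rfl⟩ := List.length_eq_two.1 hv
  calc commutator G
      ≤ rigidSection ⁅levelStab 1, levelStab 1⁆ [y] := commutator_le_rigidSection_singleton y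
    _ ≤ rigidSection (rigidSection ⁅commutator G, commutator G⁆ [x]) [y] :=
        rigidSection_mono (commutator_levelStab_one_le.trans (commutator_top_le_rigidSection x)) _
    _ ≤ rigidSection ⁅commutator G, commutator G⁆ [x, y] := rigidSection_rigidSection_le _ x _

/-! ### Normal subgroups -/

theorem commutator_commutator_le_rigidSection {N : Subgroup G} [hN : N.Normal] {g : G} (hg : g ∈ N)
    {v : Vertex} (hv : g • v ≠ v) : ⁅commutator G, commutator G⁆ ≤ rigidSection N v := by
  rw [Subgroup.commutator_le]
  intro ξ hξ ζ hζ
  obtain ⟨X, -, hX⟩ := commutator_le_rigidSection v hξ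
  obtain ⟨Y, -, hY⟩ := commutator_le_rigidSection v hζ
  -- `g X⁻¹ g⁻¹` is supported on the subtree at `g • v`, hence disjointly from `X` and `Y`.
  have hZ := hX.inv.conj g
  have hZX : Commute (g * X⁻¹ * g⁻¹) X := hZ.commute hX (length_smul g v) hv
  have hZY : Commute (g * X⁻¹ * g⁻¹) Y := hZ.commute hY (length_smul g v) hv
  have hmem : ⁅g * X⁻¹ * g⁻¹ * X, Y⁆ ∈ N := by
    have : ⁅g, X⁻¹⁆ ∈ N := commutatorElement_mem_left hg _
    rw [commutatorElement_def, inv_inv] at this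
    exact commutatorElement_mem_left this Y
  rw [commutatorElement_mul_left_of_commute hZX hZY] at hmem
  exact ⟨_, hmem, hX.commutatorElement hY⟩

theorem exists_levelStab_le {N : Subgroup G} [N.Normal] (hne : N ≠ ⊥) :
    ∃ n, levelStab n ≤ N := by
  obtain ⟨g, hg, hg1⟩ := N.bot_or_exists_ne_one.resolve_left hne
  obtain ⟨v, hv⟩ := exists_smul_ne hg1
  exact ⟨v.length + 4, levelStab_add_le fun u hu => levelStab_four_le.trans <|
    (commutator_commutator_le_rigidSection hg hv).trans (rigidSection_le_of_length_eq N hu.symm)⟩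

/-! ### Sections of level stabilizers -/

theorem exists_mem_levelStab_two_sec_one_eq_gb : ∃ d ∈ levelStab 2, sec d 1 = gb := by
  have hsec (y : Fin 3) : sec (conjB 0 * conjB 1 * conjB 2) y =
      sec gb y * sec gb (y - 1) * sec gb (y - 2) := by simp [sec_mul]
  refine ⟨conjB 0 * conjB 1 * conjB 2, mem_levelStab_succ.2 ⟨by simp, fun y => ?_⟩, ?_⟩
  · rw [mem_levelStab_one, hsec]
    fin_cases y <;> simp [show (-1 : Fin 3) = 2 from rfl, show (-2 : Fin 3) = 1 from rfl,
      show (1 - 2 : Fin 3) = 2 from rfl, show (2 - 1 : Fin 3) = 1 from rfl]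
  · rw [hsec]
    simp [show (1 - 2 : Fin 3) = 2 from rfl]

theorem sectionAt_two_surjective (v : List.Vector (Fin 3) 2) :
    Function.Surjective (sectionAt v) := by
  obtain ⟨d, hd, hd1⟩ := exists_mem_levelStab_two_sec_one_eq_gb
  have hcomm : commutator G ≤ (sectionAt v).range := fun ξ hξ => by
    obtain ⟨η, -, hη⟩ := commutator_le_rigidSection v.1 hξ
    exact ⟨⟨η, by simpa only [v.2] using hη.1⟩, hη.secWord_eq⟩
  have hconj (x : Fin 3) : ∃ s : G, s * sec gb x * s⁻¹ ∈ (sectionAt v).range := by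
    obtain ⟨s, hs, -⟩ := exists_smul_eq_secWord_eq (u := [1, x]) (v := v.1) v.2.symm 1
    have hmem : sectionAt v ⟨s * d * s⁻¹, (levelStab_normal 2).conj_mem d hd s⟩ ∈
        (sectionAt v).range := ⟨_, rfl⟩
    have heq : sectionAt v ⟨s * d * s⁻¹, (levelStab_normal 2).conj_mem d hd s⟩ =
        secWord s [1, x] * sec gb x * (secWord s [1, x])⁻¹ := by
      change secWord (s * d * s⁻¹) v.1 = _
      rw [← hs, secWord_conj s (smul_eq_of_mem_levelStab hd le_rfl), secWord_cons d, hd1]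
      rfl
    exact ⟨_, heq ▸ hmem⟩
  obtain ⟨s, hs⟩ := hconj 0
  obtain ⟨t, ht⟩ := hconj 2
  exact MonoidHom.range_eq_top.1
    (eq_top_of_commutator_le hcomm hs (by simp) (by simp) ht (by simp) (by simp))

theorem exists_mem_levelStab_secWord_eq (v : Vertex) (g : G) :
    ∃ h ∈ levelStab v.length, secWord h v = g := by
  induction v with
  | nil => exact ⟨g, mem_levelStab_zero g, rfl⟩
  | cons x v ih =>
    obtain _ | ⟨y, _ | ⟨z, w⟩⟩ := v
    · obtain ⟨h, hr, hs⟩ := exists_rotation_eq_zero_sec_eq x g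
      exact ⟨h, mem_levelStab_one.2 hr, hs⟩
    · obtain ⟨h, hh⟩ := sectionAt_two_surjective ⟨[x, y], rfl⟩ g
      exact ⟨h, h.2, hh⟩
    · obtain ⟨h, hh, rfl⟩ := ih
      have hcomm : h ∈ commutator G :=
        levelStab_two_le_commutator (levelStab_antitone (by simp) hh)
      obtain ⟨k, -, hk⟩ := commutator_le_rigidSection [x] hcomm
      obtain ⟨hr, hs⟩ := isCopyAt_singleton_iff.1 hk
      refine ⟨k, mem_levelStab_succ.2 ⟨hr, fun y => ?_⟩, ?_⟩
      · rw [hs]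
        split_ifs
        exacts [hh, one_mem _]
      · rw [secWord_cons, hs, if_pos rfl]

theorem sectionAt_surjective {n : ℕ} (v : List.Vector (Fin 3) n) :
    Function.Surjective (sectionAt v) := fun g => by
  obtain ⟨h, hh, rfl⟩ := exists_mem_levelStab_secWord_eq v.1 g
  exact ⟨⟨h, by simpa only [v.2] using hh⟩, rfl⟩

/-! ### Just infiniteness -/

instance infinite_G : Infinite G := by
  have hsurj : Function.Surjective (secHom 0) := fun g =>
    let ⟨h, hr, hs⟩ := exists_rotation_eq_zero_sec_eq 0 g
    ⟨⟨h, mem_levelStab_one.2 hr⟩, hs⟩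
  refine not_finite_iff_infinite.1 fun _ => ?_
  have hcard : Nat.card (levelStab 1) = Nat.card G :=
    le_antisymm (Subgroup.card_le_card_group _) (Nat.card_le_card_of_surjective _ hsurj)
  have hmem : ga ∈ levelStab 1 := by
    rw [Subgroup.eq_top_of_card_eq _ hcard]
    trivial
  simp [mem_levelStab_one] at hmem

theorem ne_bot_of_finiteIndex (L : Subgroup G) [L.FiniteIndex] : L ≠ ⊥ := by
  rintro rfl
  exact not_finite_iff_infinite.2 infinite_G
    ((Subgroup.finite_iff_finite_and_finiteIndex ⊥).2 ⟨inferInstance, inferInstance⟩)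

theorem eq_one_of_commute_commutator {g : G} (hg : ∀ ξ ∈ commutator G, Commute g ξ) : g = 1 := by
  by_contra hne
  obtain ⟨v, hv⟩ := exists_smul_ne hne
  refine ne_bot_of_finiteIndex (commutator G) ((Subgroup.eq_bot_iff_forall _).2 fun ξ hξ => ?_)
  obtain ⟨η, hη, hcopy⟩ := commutator_le_rigidSection v hξ
  have hconj := hcopy.conj g
  rw [(hg η hη).eq, mul_inv_cancel_right] at hconj
  rw [← hcopy.secWord_eq, hconj.2 v (length_smul g v).symm, if_neg hv.symm]

theorem finiteIndex_levelStab_one : (levelStab 1).FiniteIndex := by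
  have : Finite (Multiplicative (Fin 3)) := inferInstanceAs (Finite (Fin 3))
  have : levelStab 1 = rotationHom.ker := Subgroup.ext fun _ => mem_levelStab_one
  rw [this]
  infer_instance

instance finiteIndex_levelStab (n : ℕ) : (levelStab n).FiniteIndex := by
  have := finiteIndex_levelStab_one
  induction n with
  | zero => exact Subgroup.finiteIndex_of_le (H := levelStab 1) fun g _ => mem_levelStab_zero g
  | succ n ih =>
    have heq : levelStab (n + 1) =
        (⨅ x, (levelStab n).comap (secHom x)).map (levelStab 1).subtype := by
      ext g
      simp [mem_levelStab_succ, mem_levelStab_zero, Subgroup.mem_iInf, and_comm]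
    have : (⨅ x, (levelStab n).comap (secHom x)).FiniteIndex :=
      Subgroup.finiteIndex_iInf fun _ => inferInstance
    exact heq ▸ finiteIndex_map _ _

theorem exists_levelStab_le_of_finiteIndex (L : Subgroup G) [L.FiniteIndex] :
    ∃ n, levelStab n ≤ L := by
  obtain ⟨n, hn⟩ := exists_levelStab_le (ne_bot_of_finiteIndex L.normalCore)
  exact ⟨n, hn.trans L.normalCore_le⟩

/-- The Gupta–Sidki group is just infinite. -/
theorem finiteIndex_of_normal {N : Subgroup G} [N.Normal] (hne : N ≠ ⊥) : N.FiniteIndex := by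
  obtain ⟨n, hn⟩ := exists_levelStab_le hne
  exact Subgroup.finiteIndex_of_le hn

theorem finiteIndex_commutator_of_ne_bot {R : Subgroup G} [R.Normal] (hne : R ≠ ⊥) :
    (⁅R, commutator G⁆ : Subgroup G).FiniteIndex := by
  refine finiteIndex_of_normal fun hbot => hne ((Subgroup.eq_bot_iff_forall _).2 fun g hg => ?_)
  refine eq_one_of_commute_commutator fun ξ hξ => ?_
  rw [← commutatorElement_eq_one_iff_commute, ← Subgroup.mem_bot, ← hbot]
  exact Subgroup.commutator_mem_commutator hg hξ

/-! ### Labelled graphs and their graphs of sections -/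

universe u

/-- A graph with edges labelled by the powers of `a`, by `b` and by `b⁻¹`, closed under inversion;
the finite set `bEdges` contains every pair `(i, j)` joined by an edge labelled by `b`. -/
structure LabelledGraph (ι : Type u) where
  edge : ι → G → ι → Prop
  bEdges : Finset (ι × ι)
  symm : ∀ {i s j}, edge i s j → edge j s⁻¹ i
  label : ∀ {i s j}, edge i s j → s ∈ Subgroup.zpowers ga ∨ (s = gb ∧ (i, j) ∈ bEdges) ∨
    (s = gb⁻¹ ∧ (j, i) ∈ bEdges)

namespace LabelledGraph

variable {ι : Type u} {E F : LabelledGraph ι} {i j k : ι} {g h s : G} {m n : ℕ}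

/-- `E.Walk i g n j`: there is a walk in `E` from `i` to `j` with product of labels `g` (the last
label being the leftmost factor) and with `n` edges counted as labelled by powers of `b`. -/
inductive Walk (E : LabelledGraph ι) (i : ι) : G → ℕ → ι → Prop
  | nil : E.Walk i 1 0 i
  | consA {j k : ι} {g s : G} {n : ℕ} : E.Walk i g n j → E.edge j s k →
      s ∈ Subgroup.zpowers ga → E.Walk i (s * g) n k
  | consB {j k : ι} {g s : G} {n : ℕ} : E.Walk i g n j → E.edge j s k →
      s ∈ Subgroup.zpowers gb → E.Walk i (s * g) (n + 1) k

variable (E) in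
/-- Connectedness of two vertices by a walk. -/
def Reach (i j : ι) : Prop := ∃ g n, E.Walk i g n j

theorem Walk.reach (hw : E.Walk i g n j) : E.Reach i j := ⟨g, n, hw⟩

theorem exists_walk_of_edge (he : E.edge i s j) : ∃ n, E.Walk i s n j := by
  rw [← mul_one s]
  rcases E.label he with hs | ⟨rfl, -⟩ | ⟨rfl, -⟩
  · exact ⟨_, Walk.nil.consA he hs⟩
  · exact ⟨_, Walk.nil.consB he (Subgroup.mem_zpowers _)⟩
  · exact ⟨_, Walk.nil.consB he (inv_mem (Subgroup.mem_zpowers _))⟩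

theorem Walk.edge_induction {P : G → ι → Prop} (hw : E.Walk i g n j) (one : P 1 i)
    (mul : ∀ {g s j k}, E.Reach i j → P g j → E.edge j s k → P (s * g) k) : P g j := by
  induction hw with
  | nil => exact one
  | consA hw he _ ih => exact mul hw.reach ih he
  | consB hw he _ ih => exact mul hw.reach ih he

theorem Walk.mono (hEF : ∀ {i s j}, E.edge i s j → F.edge i s j) (hw : E.Walk i g n j) :
    F.Walk i g n j := by
  induction hw with
  | nil => exact .nil
  | consA _ he hs ih => exact ih.consA (hEF he) hs
  | consB _ he hs ih => exact ih.consB (hEF he) hs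

theorem Walk.trans (hg : E.Walk i g m j) (hh : E.Walk j h n k) : E.Walk i (h * g) (m + n) k := by
  induction hh with
  | nil => simpa using hg
  | consA _ he hs ih => rw [mul_assoc]; exact ih.consA he hs
  | consB _ he hs ih => rw [mul_assoc]; exact ih.consB he hs

theorem Walk.symm (hw : E.Walk i g n j) : E.Walk j g⁻¹ n i := by
  induction hw with
  | nil => rw [inv_one]; exact .nil
  | consA _ he hs ih => simpa using (Walk.nil.consA (E.symm he) (inv_mem hs)).trans ih
  | consB _ he hs ih =>
    simpa [add_comm] using (Walk.nil.consB (E.symm he) (inv_mem hs)).trans ih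

theorem Walk.mem_zpowers_of_eq_zero (hw : E.Walk i g n j) (hn : n = 0) :
    g ∈ Subgroup.zpowers ga := by
  induction hw with
  | nil => exact one_mem _
  | consA _ _ hs ih => exact mul_mem hs (ih hn)
  | consB => exact absurd hn (Nat.succ_ne_zero _)

theorem Reach.edge (hr : E.Reach i j) (he : E.edge j s k) : E.Reach i k :=
  let ⟨_, _, hw⟩ := hr
  let ⟨_, hs⟩ := exists_walk_of_edge he
  (hw.trans hs).reach

variable (E) in
/-- The group of labels of closed walks at a vertex. -/
def loops (i : ι) : Subgroup G where
  carrier := {g | ∃ n, E.Walk i g n i}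
  one_mem' := ⟨0, .nil⟩
  mul_mem' := fun ⟨_, hg⟩ ⟨_, hh⟩ => ⟨_, hh.trans hg⟩
  inv_mem' := fun ⟨_, hg⟩ => ⟨_, hg.symm⟩

theorem Walk.mem_loops (hw : E.Walk i g n i) : g ∈ E.loops i := ⟨n, hw⟩

theorem Walk.conj_mem_loops (hw : E.Walk i g n j) (hh : h ∈ E.loops j) :
    g⁻¹ * h * g ∈ E.loops i := by
  obtain ⟨m, hh⟩ := hh
  rw [mul_assoc]
  exact ((hw.trans hh).trans hw.symm).mem_loops

theorem Walk.map_conj_loops (hw : E.Walk i g n j) :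
    (E.loops i).map (MulAut.conj g).toMonoidHom = E.loops j := by
  ext h
  simp only [Subgroup.mem_map, MulEquiv.coe_toMonoidHom, MulAut.conj_apply]
  constructor
  · rintro ⟨h, hh, rfl⟩
    simpa using hw.symm.conj_mem_loops hh
  · exact fun hh => ⟨_, hw.conj_mem_loops hh, by group⟩

theorem Walk.mem_loops_of_mem_zpowers {c : G} (hw : E.Walk i g n j)
    (hg : g ∈ Subgroup.zpowers c) (hc : c ∈ E.loops j) : c ∈ E.loops i := by
  obtain ⟨k, rfl⟩ := hg
  have hcomm : (c ^ k)⁻¹ * c * c ^ k = c := by group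
  exact hcomm ▸ hw.conj_mem_loops hc

theorem loops_le_of_edge
    (h : ∀ {j s k}, E.Reach i j → E.edge j s k → ∃ n, F.Walk j s n k) :
    E.loops i ≤ F.loops i := fun _ ⟨_, hw⟩ =>
  hw.edge_induction (P := fun g j => ∃ n, F.Walk i g n j) ⟨0, .nil⟩
    fun hr ⟨_, hg⟩ he => let ⟨_, hs⟩ := h hr he; ⟨_, hg.trans hs⟩

variable (E) in
/-- The graph of sections: every vertex is replaced by the first level of the tree, and every label
by its sections. -/
def sectionGraph : LabelledGraph (ι × Fin 3) where
  edge p s q := ∃ t, E.edge p.1 t q.1 ∧ q.2 = p.2 + rotation t ∧ s = sec t p.2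
  bEdges := E.bEdges.map ⟨fun e => ((e.1, 2), (e.2, 2)), fun e f h => by
    simp only [Prod.mk.injEq] at h
    exact Prod.ext h.1.1 h.2.1⟩
  symm := by
    rintro p s q ⟨t, he, hq, rfl⟩
    refine ⟨t⁻¹, E.symm he, by rw [hq, rotation_inv, add_neg_cancel_right], ?_⟩
    rw [hq, sec_inv, add_sub_cancel_right]
  label := by
    rintro ⟨i, x⟩ s ⟨j, y⟩ ⟨t, he, hq, rfl⟩
    dsimp only at he hq
    rcases E.label he with ht | ⟨rfl, ht⟩ | ⟨rfl, ht⟩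
    · exact .inl (sec_eq_one_of_mem_zpowers_ga ht x ▸ one_mem _)
    · obtain rfl : y = x := by simpa using hq
      by_cases hy : y = 2
      · subst hy
        exact .inr (.inl ⟨sec_gb_two, Finset.mem_map.2 ⟨_, ht, rfl⟩⟩)
      · exact .inl (sec_gb_mem_zpowers_ga hy)
    · obtain rfl : y = x := by simpa using hq
      have hsec : sec gb⁻¹ y = (sec gb y)⁻¹ := by simp [sec_inv]
      rw [hsec]
      by_cases hy : y = 2
      · subst hy
        exact .inr (.inr ⟨by rw [sec_gb_two], Finset.mem_map.2 ⟨_, ht, rfl⟩⟩)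
      · exact .inl (inv_mem (sec_gb_mem_zpowers_ga hy))

theorem card_bEdges_sectionGraph : E.sectionGraph.bEdges.card = E.bEdges.card :=
  Finset.card_map _

theorem edge_sectionGraph (he : E.edge i s j) (x : Fin 3) :
    E.sectionGraph.edge (i, x) (sec s x) (j, x + rotation s) := ⟨s, he, rfl, rfl⟩

theorem Walk.consA_sectionGraph {p : ι × Fin 3} {y : Fin 3}
    (hw : E.sectionGraph.Walk p h n (j, y)) (he : E.edge j s k) (hs : s ∈ Subgroup.zpowers ga) :
    E.sectionGraph.Walk p (sec s y * h) n (k, y + rotation s) :=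
  hw.consA (edge_sectionGraph he y) (sec_eq_one_of_mem_zpowers_ga hs y ▸ one_mem _)

theorem Walk.consB_sectionGraph {p : ι × Fin 3} {y : Fin 3}
    (hw : E.sectionGraph.Walk p h n (j, y)) (he : E.edge j s k) (hs : s ∈ Subgroup.zpowers gb) :
    E.sectionGraph.Walk p (sec s y * h) (n + if y = 2 then 1 else 0) (k, y + rotation s) := by
  have hsec := sec_mem_zpowers rotation_gb hs y
  split_ifs with hy
  · subst hy
    exact hw.consB (edge_sectionGraph he 2) (sec_gb_two ▸ hsec)
  · exact hw.consA (edge_sectionGraph he y)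
      (Subgroup.zpowers_le.2 (sec_gb_mem_zpowers_ga hy) hsec)

theorem Walk.exists_lift (hw : E.Walk i g n j) : ∃ m : Fin 3 → ℕ, ∑ x, m x = n ∧
    ∀ x, E.sectionGraph.Walk (i, x) (sec g x) (m x) (j, x + rotation g) ∧
      (m x = n → sec g x ∈ Subgroup.zpowers gb) := by
  induction hw with
  | nil =>
    refine ⟨0, by simp, fun x => ?_⟩
    rw [sec_one, rotation_one, add_zero]
    exact ⟨.nil, fun _ => one_mem _⟩
  | @consA j k g s n _ he hs ih =>
    obtain ⟨m, hm, ih⟩ := ih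
    refine ⟨m, hm, fun x => ?_⟩
    rw [sec_mul, rotation_mul, add_comm (rotation s), ← add_assoc]
    refine ⟨(ih x).1.consA_sectionGraph he hs, fun h => ?_⟩
    rw [sec_eq_one_of_mem_zpowers_ga hs, one_mul]
    exact (ih x).2 h
  | @consB j k g s n _ he hs ih =>
    obtain ⟨m, hm, ih⟩ := ih
    refine ⟨fun x => m x + if x + rotation g = 2 then 1 else 0, ?_, fun x => ?_⟩
    · rw [Finset.sum_add_distrib, hm,
        sum_comp_add_right (fun y : Fin 3 => if y = 2 then 1 else 0) (rotation g)]
      simp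
    rw [sec_mul, rotation_mul, add_comm (rotation s), ← add_assoc]
    refine ⟨(ih x).1.consB_sectionGraph he hs, fun h => ?_⟩
    have hle : m x ≤ n := hm ▸ Finset.single_le_sum (fun _ _ => Nat.zero_le _) (Finset.mem_univ x)
    beta_reduce at h
    split_ifs at h with hx
    · rw [hx]
      have hsec := sec_mem_zpowers rotation_gb hs 2
      rw [sec_gb_two] at hsec
      exact mul_mem hsec ((ih x).2 (by omega))
    · omega

theorem Walk.exists_lift_to (hw : E.Walk i g n j) : ∃ m : Fin 3 → ℕ, ∑ x, m x = n ∧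
    ∀ x, E.sectionGraph.Walk (i, x - rotation g) (sec g (x - rotation g)) (m x) (j, x) ∧
      (m x = n → sec g (x - rotation g) ∈ Subgroup.zpowers gb) := by
  obtain ⟨m, hm, h⟩ := hw.exists_lift
  refine ⟨fun x => m (x - rotation g), ?_, fun x => ?_⟩
  · simpa only [sub_eq_add_neg, hm] using sum_comp_add_right m (-rotation g)
  · simpa only [sub_add_cancel] using h (x - rotation g)

theorem Walk.exists_proj {p q : ι × Fin 3} (hw : E.sectionGraph.Walk p h n q) :
    ∃ g m, E.Walk p.1 g m q.1 ∧ q.2 = p.2 + rotation g ∧ h = sec g p.2 := by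
  refine hw.edge_induction
    (P := fun h q => ∃ g m, E.Walk p.1 g m q.1 ∧ q.2 = p.2 + rotation g ∧ h = sec g p.2)
    ⟨1, 0, .nil, by simp, by simp⟩ ?_
  rintro _ _ q r - ⟨g, m, hg, hq, rfl⟩ ⟨t, he, hr, rfl⟩
  obtain ⟨n, ht⟩ := exists_walk_of_edge he
  refine ⟨t * g, _, hg.trans ht, ?_, ?_⟩
  · rw [hr, hq, rotation_mul, add_assoc, add_comm (rotation t)]
  · rw [sec_mul, hq]

theorem sectionSubgroup_loops (i : ι) (x : Fin 3) :
    sectionSubgroup (E.loops i) x = E.sectionGraph.loops (i, x) := by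
  ext h
  rw [mem_sectionSubgroup]
  constructor
  · rintro ⟨g, ⟨n, hg⟩, hr, rfl⟩
    obtain ⟨m, -, hm⟩ := hg.exists_lift
    exact ⟨m x, by simpa only [hr, add_zero] using (hm x).1⟩
  · rintro ⟨n, hh⟩
    obtain ⟨g, m, hg, hr, rfl⟩ := hh.exists_proj
    exact ⟨g, hg.mem_loops, by simpa using hr, rfl⟩

theorem sec_mem_loops_sectionGraph (hg : g ∈ E.loops i) (hr : rotation g = 0) (x : Fin 3) :
    sec g x ∈ E.sectionGraph.loops (i, x) :=
  sectionSubgroup_loops i x ▸ sec_mem_sectionSubgroup hg hr x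

theorem ga_mem_loops_sectionGraph (hb : gb ∈ E.loops i) {x : Fin 3} (hx : x ≠ 2) :
    ga ∈ E.sectionGraph.loops (i, x) := by
  have h := sec_mem_loops_sectionGraph hb rotation_gb
  fin_cases x
  · simpa using h 0
  · simpa using h 1
  · exact absurd rfl hx

theorem gb_mem_loops_sectionGraph (hb : gb ∈ E.loops i) : gb ∈ E.sectionGraph.loops (i, 2) := by
  simpa using sec_mem_loops_sectionGraph hb rotation_gb 2

theorem reach_sectionGraph (hg : g ∈ E.loops i) (hr : rotation g ≠ 0) (x y : Fin 3) :
    E.sectionGraph.Reach (i, x) (i, y) := by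
  have hstep {g : G} (hg : g ∈ E.loops i) : E.sectionGraph.Reach (i, x) (i, x + rotation g) := by
    obtain ⟨n, hg⟩ := hg
    obtain ⟨m, -, hm⟩ := hg.exists_lift
    exact (hm x).1.reach
  have hcases : ∀ r x y : Fin 3, r ≠ 0 → y = x ∨ y = x + r ∨ y = x + (r + r) := by decide
  rcases hcases (rotation g) x y hr with rfl | rfl | rfl
  · exact Walk.nil.reach
  · exact hstep hg
  · exact rotation_mul g g ▸ hstep (mul_mem hg hg)

variable (E) in
/-- Adjoin closed edges labelled by all the powers of `a` at a vertex. -/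
def addLoop (p : ι) : LabelledGraph ι where
  edge i s j := E.edge i s j ∨ (i = p ∧ j = p ∧ s ∈ Subgroup.zpowers ga)
  bEdges := E.bEdges
  symm := by
    rintro i s j (h | ⟨rfl, rfl, h⟩)
    · exact .inl (E.symm h)
    · exact .inr ⟨rfl, rfl, inv_mem h⟩
  label := by
    rintro i s j (h | ⟨rfl, rfl, h⟩)
    · exact E.label h
    · exact .inl h

theorem loops_addLoop {p : ι} (hp : ga ∈ E.loops p) (i : ι) :
    (E.addLoop p).loops i = E.loops i := by
  refine le_antisymm (loops_le_of_edge ?_)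
    (loops_le_of_edge fun _ he => exists_walk_of_edge (.inl he))
  rintro j s k - (he | ⟨rfl, rfl, hs⟩)
  · exact exists_walk_of_edge he
  · exact Subgroup.zpowers_le.2 hp hs

theorem walk_sectionGraph_addLoop (p : ι) (x y : Fin 3) :
    (E.addLoop p).sectionGraph.Walk (p, x) 1 0 (p, y) := by
  have hs : ga ^ (y - x).val ∈ Subgroup.zpowers ga := pow_mem (Subgroup.mem_zpowers ga) _
  have hw := (Walk.nil (i := (p, x))).consA_sectionGraph (E := E.addLoop p) (.inr ⟨rfl, rfl, hs⟩) hs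
  rwa [sec_eq_one_of_mem_zpowers_ga hs, one_mul, rotation_ga_pow, add_sub_cancel] at hw

variable (E) in
open Classical in
/-- The connected component of a vertex, on the same set of vertices. -/
noncomputable def component (r : ι) : LabelledGraph ι where
  edge i s j := E.edge i s j ∧ E.Reach r i
  bEdges := E.bEdges.filter fun e => E.Reach r e.1
  symm := fun ⟨h, hr⟩ => ⟨E.symm h, hr.edge h⟩
  label := by
    rintro i s j ⟨h, hr⟩
    rcases E.label h with h' | ⟨rfl, h'⟩ | ⟨rfl, h'⟩
    · exact .inl h'
    · exact .inr (.inl ⟨rfl, Finset.mem_filter.2 ⟨h', hr⟩⟩)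
    · exact .inr (.inr ⟨rfl, Finset.mem_filter.2 ⟨h', hr.edge h⟩⟩)

theorem loops_component (r : ι) : (E.component r).loops r = E.loops r :=
  le_antisymm (loops_le_of_edge fun _ he => exists_walk_of_edge he.1)
    (loops_le_of_edge fun hr he => exists_walk_of_edge ⟨he, hr⟩)

theorem card_bEdges_component_lt {r : ι} {e : ι × ι} (he : e ∈ E.bEdges) (hr : ¬ E.Reach r e.1) :
    (E.component r).bEdges.card < E.bEdges.card := by
  classical
  exact Finset.card_lt_card (Finset.filter_ssubset.2 ⟨e, he, hr⟩)

end LabelledGraph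

/-! ### Inductive classes of subgroups -/

/-- A class of subgroups which contains the finite subgroups and the whole group, is closed under
conjugation, and contains a subgroup as soon as it contains its first-level sections. -/
structure IsInductive (X : Subgroup G → Prop) : Prop where
  finite : ∀ H : Subgroup G, Finite H → X H
  top : X ⊤
  conj : ∀ (H : Subgroup G) (g : G), X H → X (H.map (MulAut.conj g).toMonoidHom)
  of_section : ∀ H : Subgroup G, (∀ x, X (sectionSubgroup H x)) → X H

namespace LabelledGraph

variable {ι : Type u} {E : LabelledGraph ι} {i j p q : ι} {g w : G} {n d N : ℕ} {x y z : Fin 3}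
  {X : Subgroup G → Prop}

/-- The loop groups of graphs with fewer than `N` edges labelled by `b` belong to `X`: the induction
hypothesis in the proof that all loop groups belong to an inductive class. -/
def HoldsBelow (X : Subgroup G → Prop) (N : ℕ) : Prop :=
  ∀ {ι : Type u} (E : LabelledGraph ι) (i : ι), E.bEdges.card < N → X (E.loops i)

theorem mem_of_reach (hX : IsInductive X) (hr : E.Reach i j) (hi : X (E.loops i)) :
    X (E.loops j) := by
  obtain ⟨g, n, hg⟩ := hr
  exact hg.map_conj_loops ▸ hX.conj _ g hi

theorem snd_eq_of_reach (hst : ∀ g ∈ E.loops i, rotation g = 0)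
    (hy : E.sectionGraph.Reach (i, x) (j, y)) (hz : E.sectionGraph.Reach (i, x) (j, z)) :
    y = z := by
  obtain ⟨_, _, hy⟩ := hy
  obtain ⟨_, _, hz⟩ := hz
  obtain ⟨g, _, hg, rfl, -⟩ := hy.exists_proj
  obtain ⟨h, _, hh, rfl, -⟩ := hz.exists_proj
  have hgh := hst _ (hg.trans hh.symm).mem_loops
  rw [rotation_mul, rotation_inv, neg_add_eq_zero] at hgh
  rw [hgh]

theorem mem_zpowers_gb_of_edge_sectionGraph (hst : ∀ g ∈ E.loops i, rotation g = 0)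
    (hreach : ∀ e ∈ E.bEdges, E.sectionGraph.Reach (i, x) (e.1, 2)) {q r : ι × Fin 3} {s : G}
    (hq : E.sectionGraph.Reach (i, x) q) (he : E.sectionGraph.edge q s r) :
    s ∈ Subgroup.zpowers gb := by
  obtain ⟨q, y⟩ := q
  obtain ⟨r, z⟩ := r
  have hr := hq.edge he
  rcases E.sectionGraph.label he with hs | ⟨rfl, -⟩ | ⟨rfl, -⟩
  · obtain ⟨t, ht, hz, rfl⟩ := he
    dsimp only at ht hz
    rcases E.label ht with h | ⟨rfl, h⟩ | ⟨rfl, h⟩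
    · exact sec_eq_one_of_mem_zpowers_ga h y ▸ one_mem _
    · obtain rfl := snd_eq_of_reach hst hq (hreach _ h)
      simp
    · obtain rfl : z = y := by simpa using hz
      obtain rfl := snd_eq_of_reach hst hr (hreach _ h)
      simp [sec_inv]
  · exact Subgroup.mem_zpowers gb
  · exact inv_mem (Subgroup.mem_zpowers gb)

theorem loops_sectionGraph_le_zpowers_gb (hst : ∀ g ∈ E.loops i, rotation g = 0)
    (hreach : ∀ e ∈ E.bEdges, E.sectionGraph.Reach (i, x) (e.1, 2)) :
    E.sectionGraph.loops (i, x) ≤ Subgroup.zpowers gb := fun _ ⟨_, hw⟩ =>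
  hw.edge_induction (P := fun h _ => h ∈ Subgroup.zpowers gb) (one_mem _) fun hr hg he =>
    mul_mem (mem_zpowers_gb_of_edge_sectionGraph hst hreach hr he) hg

theorem mem_of_stabilizing (hX : IsInductive X) (hN : HoldsBelow.{u} X N)
    (hE : E.bEdges.card ≤ N) (hst : ∀ g ∈ E.loops i, rotation g = 0) : X (E.loops i) := by
  refine hX.of_section _ fun x => ?_
  rw [sectionSubgroup_loops]
  by_cases hreach : ∀ e ∈ E.bEdges, E.sectionGraph.Reach (i, x) (e.1, 2)
  · have : Finite (Subgroup.zpowers gb) :=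
      (isOfFinOrder_iff_pow_eq_one.2 ⟨3, by norm_num, gb_pow_three⟩).finite_zpowers
    have hle := loops_sectionGraph_le_zpowers_gb hst hreach
    exact hX.finite _ (Finite.of_injective _ (Subgroup.inclusion_injective hle))
  · push Not at hreach
    obtain ⟨e, he, hr⟩ := hreach
    have he' : ((e.1, 2), (e.2, 2)) ∈ E.sectionGraph.bEdges := Finset.mem_map.2 ⟨e, he, rfl⟩
    rw [← loops_component]
    refine hN _ _ ((card_bEdges_component_lt he' hr).trans_le ?_)
    rwa [card_bEdges_sectionGraph]

theorem mem_of_mem_sectionGraph (hX : IsInductive X) (hN : HoldsBelow.{u} X N)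
    (hE : E.bEdges.card ≤ N) (hx : X (E.sectionGraph.loops (i, x))) : X (E.loops i) := by
  by_cases hst : ∀ g ∈ E.loops i, rotation g = 0
  · exact mem_of_stabilizing hX hN hE hst
  push Not at hst
  obtain ⟨g, hg, hr⟩ := hst
  refine hX.of_section _ fun y => ?_
  rw [sectionSubgroup_loops]
  exact mem_of_reach hX (reach_sectionGraph hg hr x y) hx

theorem exists_lt_walk_or_loops_eq_top
    (hp : ∀ x y, E.sectionGraph.Walk (p, x) 1 0 (p, y)) (hb : gb ∈ E.loops q)
    (hw : E.Walk p w d q) :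
    (∃ x ≠ 2, ∃ u, ∃ m < d, E.sectionGraph.Walk (q, x) u m (q, 2)) ∨
      ∃ y, E.sectionGraph.Reach (p, y) (q, 2) ∧ E.sectionGraph.loops (p, y) = ⊤ := by
  obtain ⟨m, hm, hlift⟩ := hw.exists_lift_to
  rw [Fin.sum_univ_three] at hm
  have hjoin (x : Fin 3) : ∃ u, E.sectionGraph.Walk (q, x) u (m x + m 2) (q, 2) :=
    ⟨_, ((hlift x).1.symm.trans (hp _ _)).trans (hlift 2).1⟩
  by_cases h0 : m 0 + m 2 < d
  · exact .inl ⟨0, by decide, (hjoin 0).imp fun _ hu => ⟨_, h0, hu⟩⟩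
  by_cases h1 : m 1 + m 2 < d
  · exact .inl ⟨1, by decide, (hjoin 1).imp fun _ hu => ⟨_, h1, hu⟩⟩
  refine .inr ⟨2 - rotation w, (hlift 2).1.reach, eq_top_of_ga_gb_mem ?_ ?_⟩
  · refine (hp _ (0 - rotation w)).mem_loops_of_mem_zpowers (one_mem _) ?_
    exact (hlift 0).1.mem_loops_of_mem_zpowers ((hlift 0).1.mem_zpowers_of_eq_zero (by omega))
      (ga_mem_loops_sectionGraph hb (by decide))
  · exact (hlift 2).1.mem_loops_of_mem_zpowers ((hlift 2).2 (by omega))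
      (gb_mem_loops_sectionGraph hb)

theorem mem_of_ga_mem_loops_of_gb_mem_loops (hX : IsInductive X) (hN : HoldsBelow.{u} X N)
    (hE : E.bEdges.card ≤ N) (ha : ga ∈ E.loops p) (hb : gb ∈ E.loops q)
    (hw : E.Walk p w d q) : X (E.loops q) := by
  induction d using Nat.strong_induction_on generalizing ι w with
  | _ d ih =>
  rw [← loops_addLoop ha] at hb ⊢
  replace hw : (E.addLoop p).Walk p w d q := hw.mono .inl
  refine mem_of_mem_sectionGraph (x := 2) hX hN hE ?_
  rcases exists_lt_walk_or_loops_eq_top (walk_sectionGraph_addLoop p) hb hw with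
    ⟨x, hx, u, m, hm, hu⟩ | ⟨y, hy, htop⟩
  · exact ih m hm (card_bEdges_sectionGraph.trans_le hE) (ga_mem_loops_sectionGraph hb hx)
      (gb_mem_loops_sectionGraph hb) hu
  · exact mem_of_reach hX hy (htop ▸ hX.top)

theorem mem_of_gb_mem_loops (hX : IsInductive X) (hN : HoldsBelow.{u} X N)
    (hE : E.bEdges.card ≤ N) (hb : gb ∈ E.loops i) : X (E.loops i) := by
  by_cases hst : ∀ g ∈ E.loops i, rotation g = 0
  · exact mem_of_stabilizing hX hN hE hst
  push Not at hst
  obtain ⟨g, hg, hr⟩ := hst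
  obtain ⟨w, d, hw⟩ := reach_sectionGraph hg hr 0 2
  exact mem_of_mem_sectionGraph hX hN hE <|
    mem_of_ga_mem_loops_of_gb_mem_loops hX hN (card_bEdges_sectionGraph.trans_le hE)
      (ga_mem_loops_sectionGraph hb (by decide)) (gb_mem_loops_sectionGraph hb) hw

theorem gb_mem_zpowers (hg : g ∈ Subgroup.zpowers gb) (hne : g ≠ 1) :
    gb ∈ Subgroup.zpowers g := by
  have hgb : gb ≠ 1 := by
    rintro h
    rw [h, Subgroup.zpowers_one_eq_bot, Subgroup.mem_bot] at hg
    exact hne hg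
  have : Fact (Nat.Prime 3) := ⟨Nat.prime_three⟩
  have hcard : Nat.card (Subgroup.zpowers gb) = 3 := by
    rw [Nat.card_zpowers, orderOf_eq_prime gb_pow_three hgb]
  obtain ⟨k, hk⟩ := mem_zpowers_of_prime_card (g := (⟨g, hg⟩ : Subgroup.zpowers gb))
    (g' := ⟨gb, Subgroup.mem_zpowers gb⟩) hcard fun h => hne (congrArg Subtype.val h)
  exact ⟨k, congrArg Subtype.val hk⟩

theorem sum_eq_of_ne_zero {M : Type*} [AddCommMonoid M] (f : Fin 3 → M) {r : Fin 3}
    (hr : r ≠ 0) : f 0 + f r + f (r + r) = ∑ x, f x := by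
  rw [Fin.sum_univ_three]
  obtain rfl | rfl : r = 1 ∨ r = 2 := by omega
  · rfl
  · exact add_right_comm _ _ _

theorem exists_walk_sectionGraph_of_rotation_ne_zero (hw : E.Walk i g n i)
    (hr : rotation g ≠ 0) : ∃ h, E.sectionGraph.Walk (i, 0) h n (i, 0) ∧ rotation h = 0 ∧
      exponentB h = exponentB g := by
  obtain ⟨m, hm, hlift⟩ := hw.exists_lift
  set r := rotation g
  have hw := ((hlift 0).1.trans (hlift (0 + r)).1).trans (hlift (0 + r + r)).1
  have hrrr : (0 : Fin 3) + r + r + r = 0 := by omega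
  rw [hrrr, zero_add, sum_eq_of_ne_zero m hr, hm] at hw
  refine ⟨_, hw, ?_, ?_⟩
  · rw [rotation_mul, rotation_mul, add_comm, add_comm (rotation (sec g r)),
      sum_eq_of_ne_zero (fun x => rotation (sec g x)) hr, sum_rotation_sec]
  · rw [exponentB_mul, exponentB_mul, add_comm, add_comm (exponentB (sec g r)),
      sum_eq_of_ne_zero (fun x => exponentB (sec g x)) hr, sum_exponentB_sec]

theorem exists_lt_walk_or_gb_mem_loops (hw : E.Walk i g n i) (hr : rotation g = 0)
    (hb : exponentB g ≠ 0) :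
    ∃ x, (∃ h, ∃ m < n, E.sectionGraph.Walk (i, x) h m (i, x) ∧ exponentB h ≠ 0) ∨
      gb ∈ E.sectionGraph.loops (i, x) := by
  obtain ⟨m, hm, hlift⟩ := hw.exists_lift
  simp only [hr, add_zero] at hlift
  rw [← sum_exponentB_sec] at hb
  obtain ⟨x, -, hx⟩ := Finset.exists_ne_zero_of_sum_ne_zero hb
  refine ⟨x, ?_⟩
  have hle : m x ≤ n := hm ▸ Finset.single_le_sum (fun _ _ => Nat.zero_le _) (Finset.mem_univ x)
  rcases hle.lt_or_eq with hlt | heq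
  · exact .inl ⟨_, _, hlt, (hlift x).1, hx⟩
  · have hne : sec g x ≠ 1 := fun h => hx (by rw [h, exponentB_one])
    exact .inr (Subgroup.zpowers_le.2 (hlift x).1.mem_loops (gb_mem_zpowers ((hlift x).2 heq) hne))

theorem mem_of_exponentB_ne_zero (hX : IsInductive X) (hN : HoldsBelow.{u} X N)
    (hE : E.bEdges.card ≤ N) (hw : E.Walk i g n i) (hb : exponentB g ≠ 0) : X (E.loops i) := by
  induction n using Nat.strong_induction_on generalizing ι g with
  | _ n ih =>
  wlog hr : rotation g = 0 generalizing ι g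
  · obtain ⟨h, hh, hr, hexp⟩ := exists_walk_sectionGraph_of_rotation_ne_zero hw hr
    exact mem_of_mem_sectionGraph hX hN hE
      (this (card_bEdges_sectionGraph.trans_le hE) hh (hexp ▸ hb) hr)
  obtain ⟨x, ⟨h, m, hlt, hh, hexp⟩ | hgb⟩ := exists_lt_walk_or_gb_mem_loops hw hr hb
  · exact mem_of_mem_sectionGraph hX hN hE
      (ih m hlt (card_bEdges_sectionGraph.trans_le hE) hh hexp)
  · exact mem_of_mem_sectionGraph hX hN hE
      (mem_of_gb_mem_loops hX hN (card_bEdges_sectionGraph.trans_le hE) hgb)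

theorem mem_of_card_bEdges_le (hX : IsInductive X) (hN : HoldsBelow.{u} X N)
    (hE : E.bEdges.card ≤ N) : X (E.loops i) := by
  have hE' : E.sectionGraph.bEdges.card ≤ N := card_bEdges_sectionGraph.trans_le hE
  by_cases hexp : ∀ x, ∀ g ∈ E.sectionGraph.loops (i, x), exponentB g = 0
  · refine mem_of_mem_sectionGraph (x := 0) hX hN hE (mem_of_stabilizing hX hN hE' fun h hh => ?_)
    rw [← sectionSubgroup_loops, mem_sectionSubgroup] at hh
    obtain ⟨g, hg, hr, rfl⟩ := hh
    have hsec (x : Fin 3) := hexp x _ (sec_mem_loops_sectionGraph hg hr x)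
    rw [rotation_sec, hsec, hsec, sub_zero]
  · push Not at hexp
    obtain ⟨x, g, ⟨n, hw⟩, hb⟩ := hexp
    exact mem_of_mem_sectionGraph hX hN hE (mem_of_exponentB_ne_zero hX hN hE' hw hb)

theorem mem_loops_of_isInductive (hX : IsInductive X) (E : LabelledGraph ι) (i : ι) :
    X (E.loops i) := by
  suffices ∀ N, HoldsBelow.{u} X N from this _ E i (Nat.lt_succ_self _)
  intro N
  induction N with
  | zero => exact fun E i h => absurd h (Nat.not_lt_zero _)
  | succ N hN => exact fun E i h => mem_of_card_bEdges_le hX hN (Nat.lt_succ_iff.1 h)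

/-! ### Schreier graphs -/

variable {α : Type u} [MulAction G α]

/-- The Schreier graph of an action, in which only the edges labelled by `b` from `S` are kept. -/
def schreierGraph (S : Finset (α × α)) : LabelledGraph α where
  edge i s j := j = s • i ∧ (s ∈ Subgroup.zpowers ga ∨ (s = gb ∧ (i, j) ∈ S) ∨
    (s = gb⁻¹ ∧ (j, i) ∈ S))
  bEdges := S
  symm := by
    rintro i s j ⟨rfl, h | ⟨rfl, h⟩ | ⟨rfl, h⟩⟩
    · exact ⟨by simp, .inl (inv_mem h)⟩
    · exact ⟨by simp, .inr (.inr ⟨rfl, h⟩)⟩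
    · exact ⟨by simp, .inr (.inl ⟨by simp, h⟩)⟩
  label h := h.2

variable {S T : Finset (α × α)} {i j : α}

theorem edge_schreierGraph_mono (hST : S ⊆ T) {s : G} (h : (schreierGraph S).edge i s j) :
    (schreierGraph T).edge i s j :=
  ⟨h.1, h.2.imp id (.imp (.imp id fun h => hST h) (.imp id fun h => hST h))⟩

theorem Walk.eq_smul (hw : (schreierGraph S).Walk i g n j) : j = g • i :=
  hw.edge_induction (P := fun g j => j = g • i) (one_smul _ _).symm fun _ hg he => by
    rw [he.1, hg, mul_smul]

theorem exists_schreierGraph_walk (g : G) (i : α) :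
    ∃ S n, (schreierGraph S).Walk i g n (g • i) := by
  classical
  induction g using induction_left with
  | one => exact ⟨∅, 0, by rw [one_smul]; exact .nil⟩
  | ga_mul g ih =>
    obtain ⟨S, n, hw⟩ := ih
    have he : (schreierGraph S).edge (g • i) ga (ga • g • i) :=
      ⟨rfl, .inl (Subgroup.mem_zpowers _)⟩
    exact ⟨S, n, mul_smul ga g i ▸ hw.consA he (Subgroup.mem_zpowers _)⟩
  | gb_mul g ih =>
    obtain ⟨S, n, hw⟩ := ih
    have he : (schreierGraph (insert (g • i, gb • g • i) S)).edge (g • i) gb (gb • g • i) :=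
      ⟨rfl, .inr (.inl ⟨rfl, Finset.mem_insert_self _ _⟩)⟩
    have hw' := hw.mono (edge_schreierGraph_mono (Finset.subset_insert (g • i, gb • g • i) S))
    exact ⟨_, _, mul_smul gb g i ▸ hw'.consB he (Subgroup.mem_zpowers _)⟩

theorem exists_loops_schreierGraph_eq_stabilizer (hi : (MulAction.stabilizer G i).FG) :
    ∃ S, (schreierGraph S).loops i = MulAction.stabilizer G i := by
  classical
  obtain ⟨T, hT⟩ := hi
  choose S n hS using fun g : G => exists_schreierGraph_walk g i
  refine ⟨T.biUnion S, le_antisymm (fun g ⟨n, hw⟩ => hw.eq_smul.symm) ?_⟩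
  rw [← hT, Subgroup.closure_le]
  intro g hg
  have hfix : g • i = i := hT.le (Subgroup.subset_closure hg)
  have hw := (hS g).mono (edge_schreierGraph_mono (Finset.subset_biUnion_of_mem S hg))
  exact Walk.mem_loops (hfix ▸ hw)

end LabelledGraph

theorem IsInductive.mem_of_fg {X : Subgroup G → Prop} (hX : IsInductive X) {H : Subgroup G}
    (hH : H.FG) : X H := by
  rw [← MulAction.stabilizer_quotient H] at hH ⊢
  obtain ⟨S, hS⟩ := LabelledGraph.exists_loops_schreierGraph_eq_stabilizer hH
  exact hS ▸ LabelledGraph.mem_loops_of_isInductive hX _ _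

/-! ### Normal subgroups of level stabilizers -/

section SectionSupport

variable {n : ℕ} {M : Subgroup (levelStab n)}

theorem commutator_map_sectionAt_le [M.Normal] (v : List.Vector (Fin 3) n) :
    ⁅M.map (sectionAt v), commutator G⁆ ≤
      (M.map (sections n)).comap (MonoidHom.mulSingle (fun _ => G) v) := by
  rw [Subgroup.commutator_le]
  rintro _ ⟨m, hm, rfl⟩ ξ hξ
  obtain ⟨η, -, hcopy⟩ := commutator_le_rigidSection v.1 hξ
  have hη : η ∈ levelStab n := by simpa only [v.2] using hcopy.1
  refine ⟨⁅m, ⟨η, hη⟩⁆, commutatorElement_mem_left hm _, ?_⟩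
  rw [map_commutatorElement, hcopy.sections_eq hη]
  funext u
  rcases eq_or_ne u v with rfl | hu
  · simp [commutatorElement_def, sectionAt]
  · simp [commutatorElement_def, hu]

/-- The vertices of the `n`-th level at which some element of `M` has a nontrivial section. -/
def sectionSupport (M : Subgroup (levelStab n)) : Set (List.Vector (Fin 3) n) :=
  {v | ∃ m ∈ M, sectionAt v m ≠ 1}

/-- The sections at the vertices in the support of `M`. -/
noncomputable def supportSections (M : Subgroup (levelStab n)) :
    levelStab n →* (sectionSupport M → G) :=
  MonoidHom.pi fun v => sectionAt v.1

theorem disjoint_ker_supportSections : Disjoint M (supportSections M).ker := by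
  refine Subgroup.disjoint_def.2 fun {m} hm hker => sections_injective n ?_
  rw [map_one]
  funext v
  by_contra hne
  exact hne (congrFun hker ⟨v, m, hm, hne⟩)

instance finiteIndex_map_supportSections [hM : M.Normal] :
    (M.map (supportSections M)).FiniteIndex := by
  let D (v : sectionSupport M) : Subgroup G := ⁅M.map (sectionAt v.1), commutator G⁆
  have hD (v) : (D v).FiniteIndex := by
    have := hM.map _ (sectionAt_surjective v.1)
    obtain ⟨m, hm, hne⟩ := v.2
    refine finiteIndex_commutator_of_ne_bot fun hbot => hne ?_
    exact (Subgroup.eq_bot_iff_forall _).1 hbot _ ⟨m, hm, rfl⟩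
  have := finiteIndex_pi D hD
  refine Subgroup.finiteIndex_of_le (H := Subgroup.pi Set.univ D) fun x hx => ?_
  refine Subgroup.pi_mem_of_mulSingle_mem _ fun v => ?_
  obtain ⟨m, hm, hmx⟩ := commutator_map_sectionAt_le v.1 (hx v trivial)
  refine ⟨m, hm, funext fun u => (congrFun hmx u.1).trans ?_⟩
  simp [Pi.mulSingle_apply, Subtype.ext_iff]

end SectionSupport

/-! ### Virtual powers -/

/-- The isomorphism splitting functions on a disjoint union, used to multiply powers of a group. -/
def sumArrowMulEquiv (α β M : Type*) [Mul M] : (α ⊕ β → M) ≃* (α → M) × (β → M) where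
  toEquiv := Equiv.sumArrowEquivProdArrow α β M
  map_mul' _ _ := rfl

/-- A group is a virtual power if it is commensurable with a finite power of the Gupta–Sidki group;
finite groups are included, as the exponent may be zero. -/
def IsVirtualPower (H : Type) [Group H] : Prop :=
  ∃ (ι : Type) (_ : Finite ι), AbstractlyCommensurable H (ι → G)

theorem isVirtualPower_of_finite (H : Type) [Group H] [Finite H] : IsVirtualPower H :=
  ⟨Empty, inferInstance, ⊥, ⊥, inferInstance, inferInstance, ⟨MulEquiv.ofUnique⟩⟩

section IsVirtualPower

variable {H K : Type} [Group H] [Group K]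

theorem IsVirtualPower.of_commensurable (hK : IsVirtualPower K) (h : AbstractlyCommensurable H K) :
    IsVirtualPower H :=
  let ⟨ι, hι, hK⟩ := hK
  ⟨ι, hι, h.trans hK⟩

theorem IsVirtualPower.prod (hH : IsVirtualPower H) (hK : IsVirtualPower K) :
    IsVirtualPower (H × K) := by
  obtain ⟨ι, hι, hH⟩ := hH
  obtain ⟨κ, hκ, hK⟩ := hK
  exact ⟨ι ⊕ κ, inferInstance, (hH.prod hK).trans (.of_mulEquiv (sumArrowMulEquiv ι κ G).symm)⟩

theorem exists_virtual_complement {n : ℕ} {r : H →* levelStab n} (hr : Function.Surjective r)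
    {N : Subgroup H} [hN : N.Normal] (hdisj : Disjoint N r.ker) :
    IsVirtualPower N ∧ ∃ C : Subgroup H, Disjoint N C ∧ (N ⊔ C).FiniteIndex ∧
      AbstractlyCommensurable H (N × C) := by
  have := hN.map r hr
  let q : H →* (sectionSupport (N.map r) → G) := (supportSections (N.map r)).comp r
  have hq : Disjoint N q.ker := Subgroup.disjoint_def.2 fun hm hker =>
    Subgroup.disjoint_def.1 hdisj hm <|
      Subgroup.disjoint_def.1 disjoint_ker_supportSections (Subgroup.mem_map_of_mem r hm) hker
  have : (N.map q).FiniteIndex := by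
    rw [← Subgroup.map_map]
    infer_instance
  refine ⟨⟨sectionSupport (N.map r), inferInstance, .of_disjoint_ker hq⟩, q.ker, hq, ?_,
    .prod_ker_of_disjoint_ker hq⟩
  rw [← Subgroup.comap_map_eq]
  infer_instance

end IsVirtualPower

theorem isVirtualPower_of_homs {ι : Type} [Finite ι] : ∀ {H : Type} [Group H] (p : ι → H →* G),
    (∀ h, (∀ i, p i h = 1) → h = 1) → (∀ i, (p i).range.FiniteIndex) → IsVirtualPower H := by
  induction ι using Finite.induction_empty_option with
  | of_equiv e ih =>
    exact fun p hinj hp => ih (fun i => p (e i)) (fun h hh => hinj h (e.forall_congr_right.1 hh))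
      fun i => hp (e i)
  | h_empty =>
    intro H _ p hinj _
    have : Subsingleton H :=
      ⟨fun x y => (hinj x fun i => i.elim).trans (hinj y fun i => i.elim).symm⟩
    exact isVirtualPower_of_finite H
  | @h_option ι _ ih =>
    intro H _ p hinj hp
    obtain ⟨n, hn⟩ := exists_levelStab_le_of_finiteIndex (p none).range
    let r := (p none).subgroupComap (levelStab n)
    have hr : Function.Surjective r := by
      rw [← MonoidHom.range_eq_top, range_subgroupComap]
      exact Subgroup.subgroupOf_eq_top.2 hn
    let p' (i : ι) := (p (some i)).comp ((levelStab n).comap (p none)).subtype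
    let N := ⨅ i, (p' i).ker
    have hN : N.Normal := Subgroup.normal_iInf_normal fun _ => inferInstance
    have hdisj : Disjoint N r.ker := Subgroup.disjoint_def.2 fun {h} hh hker =>
      Subtype.ext (hinj h (Option.forall.2 ⟨Subtype.ext_iff.1 hker, Subgroup.mem_iInf.1 hh⟩))
    obtain ⟨hNpow, C, hNC, hsup, hcomm⟩ := exists_virtual_complement hr hdisj
    have hCpow : IsVirtualPower C := by
      refine ih (fun i => (p' i).comp C.subtype) (fun c hc => ?_) fun i => ?_
      · exact Subtype.ext (Subgroup.disjoint_def.1 hNC (Subgroup.mem_iInf.2 hc) c.2)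
      · have := hp (some i)
        exact finiteIndex_range_comp_subtype (p' i) (show N ≤ _ from iInf_le _ i)
    exact (hNpow.prod hCpow).of_commensurable ((AbstractlyCommensurable.of_subgroup _).trans hcomm)

theorem IsVirtualPower.exists_homs {H : Type} [Group H] (h : IsVirtualPower H) :
    ∃ (A : Subgroup H) (_ : A.FiniteIndex) (ι : Type) (_ : Finite ι) (p : ι → A →* G),
      (∀ h, (∀ i, p i h = 1) → h = 1) ∧ ∀ i, (p i).range.FiniteIndex := by
  obtain ⟨ι, hι, A, B, hA, hB, ⟨e⟩⟩ := h
  refine ⟨A, hA, ι, hι, fun i => (Pi.evalMonoidHom (fun _ => G) i).comp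
    (B.subtype.comp e.toMonoidHom), fun h hh => ?_, fun i => inferInstance⟩
  exact (MulEquiv.map_eq_one_iff e).1 (Subtype.ext (funext hh))

theorem isVirtualPower_of_forall {X : Type} [Finite X] {H : Type} [Group H] {K : X → Type}
    [∀ x, Group (K x)] (hK : ∀ x, IsVirtualPower (K x)) (f : ∀ x, H →* K x)
    (hinj : ∀ h, (∀ x, f x h = 1) → h = 1) (hf : ∀ x, (f x).range.FiniteIndex) :
    IsVirtualPower H := by
  choose A hA ι hι p hpinj hp using fun x => (hK x).exists_homs
  let H₀ := ⨅ x, (A x).comap (f x)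
  have : H₀.FiniteIndex := Subgroup.finiteIndex_iInf fun _ => inferInstance
  let r (x : X) : H₀ →* A x :=
    ((f x).subgroupComap (A x)).comp (Subgroup.inclusion (iInf_le _ x))
  have hpow : IsVirtualPower H₀ := by
    refine isVirtualPower_of_homs (fun j : Σ x, ι x => (p j.1 j.2).comp (r j.1)) (fun h hh => ?_)
      fun j => ?_
    · refine Subtype.ext (hinj h fun x => ?_)
      exact Subtype.ext_iff.1 (hpinj x (r x h) fun i => hh ⟨x, i⟩)
    · have := hp j.1 j.2
      have := hf j.1
      infer_instance
  exact hpow.of_commensurable (.of_subgroup H₀)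

theorem isVirtualPower_of_sectionSubgroup {H : Subgroup G}
    (h : ∀ x, IsVirtualPower (sectionSubgroup H x)) : IsVirtualPower H := by
  have hstab : IsVirtualPower (H.subgroupOf (levelStab 1)) := by
    refine isVirtualPower_of_forall h (fun x => (secHom x).subgroupMap _) (fun g hg => ?_)
      fun x => finiteIndex_range_of_surjective ((secHom x).subgroupMap_surjective _)
    have hsec (x) : sec g x = 1 := Subtype.ext_iff.1 (hg x)
    refine Subtype.ext (Subtype.ext (ext_sec ?_ fun x => (hsec x).trans (sec_one x).symm))
    exact (mem_levelStab_one.1 g.1.2).trans rotation_one.symm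
  exact hstab.of_commensurable (AbstractlyCommensurable.of_subgroupOf H (levelStab 1)).symm

theorem isInductive_isVirtualPower : IsInductive fun H => IsVirtualPower H where
  finite H _ := isVirtualPower_of_finite H
  top := ⟨Unit, inferInstance,
    .of_mulEquiv (Subgroup.topEquiv.trans (MulEquiv.funUnique Unit G).symm)⟩
  conj H g h := h.of_commensurable
    (.of_mulEquiv (H.equivMapOfInjective _ (MulAut.conj g).injective).symm)
  of_section _ := isVirtualPower_of_sectionSubgroup

/-! ### Powers of the Gupta–Sidki group -/

theorem commensurable_fin_three : AbstractlyCommensurable (Fin 3 → G) G := by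
  let ψ : levelStab 1 →* (Fin 3 → G) := MonoidHom.pi secHom
  have hψ : Function.Injective ψ := fun g h hgh => Subtype.ext <|
    ext_sec ((mem_levelStab_one.1 g.2).trans (mem_levelStab_one.1 h.2).symm) (congrFun hgh)
  have hle : Subgroup.pi Set.univ (fun _ => commutator G) ≤ ψ.range := fun x hx => by
    refine Subgroup.pi_mem_of_mulSingle_mem _ fun i => ?_
    obtain ⟨η, -, hη⟩ := commutator_le_rigidSection [i] (hx i trivial)
    refine ⟨⟨η, hη.1⟩, funext fun y => ?_⟩
    rw [Pi.mulSingle_apply]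
    exact (isCopyAt_singleton_iff.1 hη).2 y
  have := finiteIndex_pi (fun _ : Fin 3 => commutator G) fun _ => inferInstance
  have : ψ.range.FiniteIndex := Subgroup.finiteIndex_of_le hle
  exact ((AbstractlyCommensurable.of_subgroup _).trans (.of_injective hψ)).symm

theorem commensurable_fin_succ (m : ℕ) :
    AbstractlyCommensurable (Fin (m + 1) → G) ((Fin m → G) × G) :=
  .of_mulEquiv <| ((MulEquiv.arrowCongr finSumFinEquiv.symm (.refl G)).trans
    (sumArrowMulEquiv _ _ _)).trans ((MulEquiv.refl _).prodCongr (.funUnique (Fin 1) G))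

theorem commensurable_fin_pos (m : ℕ) : AbstractlyCommensurable (Fin (m + 1) → G) G ∨
    AbstractlyCommensurable (Fin (m + 1) → G) (G × G) := by
  have hrefl : AbstractlyCommensurable G G := .of_mulEquiv (.refl G)
  have hone : AbstractlyCommensurable (Fin 1 → G) G := .of_mulEquiv (.funUnique (Fin 1) G)
  have htwo : AbstractlyCommensurable (Fin 2 → G) (G × G) :=
    (commensurable_fin_succ 1).trans (hone.prod hrefl)
  have hthree : AbstractlyCommensurable ((G × G) × G) G :=
    ((commensurable_fin_succ 2).trans (htwo.prod hrefl)).symm.trans commensurable_fin_three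
  induction m with
  | zero => exact .inl hone
  | succ m ih =>
    have hsucc := commensurable_fin_succ (m + 1)
    rcases ih with h | h
    · exact .inr (hsucc.trans (h.prod hrefl))
    · exact .inl ((hsucc.trans (h.prod hrefl)).trans hthree)

end GuptaSidki

theorem theorem1 (H : Subgroup GuptaSidki.G) (hfg : H.FG) (hinf : Infinite H) :
    AbstractlyCommensurable H GuptaSidki.G ∨
      AbstractlyCommensurable H (GuptaSidki.G × GuptaSidki.G) := by
  obtain ⟨ι, _, hι⟩ := GuptaSidki.isInductive_isVirtualPower.mem_of_fg hfg
  obtain ⟨n, ⟨e⟩⟩ := Finite.exists_equiv_fin ι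
  have h : AbstractlyCommensurable H (Fin n → GuptaSidki.G) :=
    hι.trans (.of_mulEquiv (MulEquiv.arrowCongr e (.refl GuptaSidki.G)))
  cases n with
  | zero => exact absurd (h.finite_iff.2 inferInstance) (not_finite_iff_infinite.2 hinf)
  | succ m => exact (GuptaSidki.commensurable_fin_pos m).imp h.trans h.trans
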